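/- Let $n \ge 1$, $[n] = \{1,\dots,n\}$, and let $\mathcal{P}_n$ be the family of all subsets of $[n]$. By a *measure* on $\mathbb{R}^n$ we mean a finite signed Borel measure; $|\mu|$ denotes the total variation of $\mu$, and $\mu$ is *integrable* if $\int \|x\|_2\,|\mu|(dx) < \infty$. For $x, y \in \mathbb{R}^n$ let $xy$ be the componentwise product. The *multiplicative convolution* of two measures is $$(\mu \circledast \nu)(A) = \int \mu(dx) \int \nu(dy)\, \mathbf{1}_A(xy), \qquad A \text{ Borel}.$$ A measure $\nu$ is *universal* on a set $\mathscr{A}$ of measures if, for every $\mu \in \mathscr{A}$, $\nu \circledast \mu = 0$ implies $\mu = 0$. For $E \subset [n]$ let: * $A_E = \{x \in \mathbb{R}^n : x_i \neq 0 \Leftrightarrow i \in E \text{ for all } i\}$, and $R_E(\mu) = \mu_E = \mu(\,\cdot \cap A_E)$; the measure $\mu$ is *of order* $E$ if $|\mu|(A_E) > 0$ and $|\mu|(A_F) = 0$ for all $F \neq E$; * $P_E$ be the orthogonal projection of $\mathbb{R}^n$ onto the span of the standard basis vectors $e_i$, $i \in E$, and $P_E(\mu) = \mu \circ P_E^{-1}$;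 * $T_E$ be the map that changes the sign of the coordinates $x_i$, $i \in E$; the measure $\mu$ is *even* (*odd*) under $T_E$ if $\mu \circ T_E^{-1} = \mu$ ($\mu \circ T_E^{-1} = -\mu$). For $J \subset E \subset [n]$ let $$\delta_{E,J} = 2^{-|E|} \sum_{s} \Big(\prod_{j \in J} s_j\Big)\, \delta_s,$$ where $s$ runs through all vectors with $s_i \in \{-1, 1\}$ for $i \in E$ and $s_i = 0$ for $i \notin E$, and $\delta_s$ is the Dirac measure at $s$ (so $\delta_{\emptyset,\emptyset} = \delta_0$); write $\delta_J = \delta_{[n],J}$. For $\mathcal{F}_e, \mathcal{F}_o \subset \mathcal{P}_n$ and $A = A_{[n]}$ or $A = \mathbb{R}^n$, let $\mathcal{M}^{\rm int}(A; \mathcal{F}_e, \mathcal{F}_o)$ be the set of integrable measures concentrated on $A$ that are even under $T_F$ for all $F \in \mathcal{F}_e$ and odd under $T_F$ for all $F \in \mathcal{F}_o$. For $E \subset [n]$ let $\mathcal{J}(E; \mathcal{F}_e, \mathcal{F}_o)$ be the family of all $J \subset E$ such that $|J \cap F|$ is even for every $F \in \mathcal{F}_e$ and odd for every $F \in \mathcal{F}_o$,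 and write $\mathcal{J}(\mathcal{F}_e, \mathcal{F}_o) = \mathcal{J}([n]; \mathcal{F}_e, \mathcal{F}_o)$. For $\mathcal{F} \subset \mathcal{P}_n$ let $\mathcal{F}|_E = \{F \cap E : F \in \mathcal{F}\}$. Let $\mathcal{G}$ be the subgroup of $(\mathcal{P}_n, \Delta)$, with $\Delta$ the symmetric difference, generated by $\mathcal{F}_e \cup \mathcal{F}_o$. Its *even part* $\mathcal{G}_e$ (*odd part* $\mathcal{G}_o$) consists of all sets that can be written as a finite symmetric difference of members of $\mathcal{F}_e$ and an even (odd) number of members of $\mathcal{F}_o$, repetitions being allowed and the empty symmetric difference being $\emptyset$. The pair $(\mathcal{F}_e, \mathcal{F}_o)$ is *proper* if $\mathcal{G}_e \cap \mathcal{G}_o = \emptyset$; the same notion applies to the pair $(\mathcal{F}_e|_E, \mathcal{F}_o|_E)$ in place of $(\mathcal{F}_e, \mathcal{F}_o)$. **Corollary.** Let $\mathcal{F}_e, \mathcal{F}_o \subset \mathcal{P}_n$ and let $\nu$ be an integrable measure on $\mathbb{R}^n$. Then: 1. $\nu$ is universal on $\mathcal{M}^{\rm int}(A_{[n]}; \mathcal{F}_e,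 \mathcal{F}_o)$ if and only if $\delta_J \circledast \nu_{[n]} \neq 0$ for all $J \in \mathcal{J}(\mathcal{F}_e, \mathcal{F}_o)$. 2. $\nu$ is universal on $\mathcal{M}^{\rm int}(\mathbb{R}^n; \mathcal{F}_e, \mathcal{F}_o)$ if and only if $\delta_J \circledast R_E P_E(\nu) \neq 0$ for all $E \subset [n]$ and all $J \in \mathcal{J}(E; \mathcal{F}_e, \mathcal{F}_o)$. 3. If $\nu$ is of order $[n]$, then $\nu$ is universal on $\mathcal{M}^{\rm int}(\mathbb{R}^n; \mathcal{F}_e, \mathcal{F}_o)$ if and only if $\delta_{J,J} \circledast \nu \neq 0$ for all $J \in \mathcal{J}(\mathcal{F}_e, \mathcal{F}_o)$. In this case (that is, if $\nu$ is of order $[n]$ and universal on $\mathcal{M}^{\rm int}(\mathbb{R}^n; \mathcal{F}_e, \mathcal{F}_o)$), whenever $G \subset E \subset [n]$, the pair $(\mathcal{F}_e|_E, \mathcal{F}_o|_E)$ is proper and $P_E(\nu)$ is even (odd) under $T_G$, then $G \in \mathcal{G}_e|_E$ ($G \in \mathcal{G}_o|_E$). -/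

import Mathlib

open MeasureTheory

namespace MultConv

noncomputable section

/-! Points of `ℝⁿ` are functions `Fin n → ℝ`, whose product `x * y` is the componentwise one and
whose σ-algebra is the Borel one. A "measure on `ℝⁿ`" is a finite signed measure on the Borel sets,
and `μ.variation` is its total variation `|μ|`. Subsets of `[n]` are of type `Finset (Fin n)`,
families of subsets of `[n]` are of type `Set (Finset (Fin n))`. -/

variable {n : ℕ}

/-- The total variation of a finite signed measure is finite. -/
instance isFiniteMeasure_variation {X : Type*} [MeasurableSpace X] (μ : SignedMeasure X) :
    IsFiniteMeasure μ.variation := by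
  rw [← SignedMeasure.totalVariation_eq_variation, SignedMeasure.totalVariation]
  infer_instance

/-- The multiplicative convolution `μ ⊛ ν`: the image of the product measure `μ ⊗ ν` under the
componentwise product `(x, y) ↦ x * y`. -/
def mulConv (μ ν : SignedMeasure (Fin n → ℝ)) : SignedMeasure (Fin n → ℝ) :=
  (VectorMeasure.prod μ ν (ContinuousLinearMap.lsmul ℝ ℝ).flip).map fun p => p.1 * p.2

/-- `(μ ⊛ ν)(A) = ∫ μ(dx) ∫ ν(dy) 1_A(x y)`. -/
theorem mulConv_apply (μ ν : SignedMeasure (Fin n → ℝ)) {A : Set (Fin n → ℝ)}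
    (hA : MeasurableSet A) :
    mulConv μ ν A = ∫ᵛ x, (∫ᵛ y, A.indicator (fun _ => (1 : ℝ)) (x * y) ∂•ν) ∂•μ := by
  have hm : Measurable fun p : (Fin n → ℝ) × (Fin n → ℝ) => p.1 * p.2 := by fun_prop
  rw [mulConv, VectorMeasure.map_apply _ hm hA, VectorMeasure.prod_apply_eq_integral (hm hA)]
  change ∫ᵛ x, ν ((fun y => x * y) ⁻¹' A) ∂•μ = _
  congr 1
  ext x
  have hx : MeasurableSet ((fun y => x * y) ⁻¹' A) := (by fun_prop : Measurable fun y => x * y) hA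
  have hi : (fun y => A.indicator (fun _ => (1 : ℝ)) (x * y)) =
      ((fun y => x * y) ⁻¹' A).indicator fun _ => (1 : ℝ) := rfl
  rw [hi, VectorMeasure.integral_indicator hx]
  simp

/-- `μ` is integrable: `∫ ‖x‖₂ |μ|(dx) < ∞`, with the Euclidean norm. -/
def IsIntegrable (μ : SignedMeasure (Fin n → ℝ)) : Prop :=
  μ.Integrable fun x => ‖WithLp.toLp 2 x‖

/-- `μ` is concentrated on `A`: it vanishes on every Borel subset of the complement of `A`. -/
def ConcentratedOn (μ : SignedMeasure (Fin n → ℝ)) (A : Set (Fin n → ℝ)) : Prop :=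
  ∀ B, MeasurableSet B → B ⊆ Aᶜ → μ B = 0

/-- `A_E`, the set of all `x` whose non-zero coordinates are exactly those in `E`. -/
def stratum (E : Finset (Fin n)) : Set (Fin n → ℝ) := {x | ∀ i, x i ≠ 0 ↔ i ∈ E}

theorem measurableSet_stratum (E : Finset (Fin n)) : MeasurableSet (stratum E) := by
  have h : stratum E = ⋂ i, {x : Fin n → ℝ | x i ≠ 0 ↔ i ∈ E} := by
    ext x; simp [stratum]
  rw [h]
  refine MeasurableSet.iInter fun i => ?_
  have h0 : MeasurableSet {x : Fin n → ℝ | x i = 0} :=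
    measurableSet_eq_fun (measurable_pi_apply i) measurable_const
  by_cases hi : i ∈ E
  · simp only [hi, iff_true]
    exact h0.compl
  · simpa [hi] using h0

/-- The restriction `R_E(μ) = μ_E`, that is `μ_E(A) = μ(A ∩ A_E)`. -/
def coordPart (E : Finset (Fin n)) (μ : SignedMeasure (Fin n → ℝ)) : SignedMeasure (Fin n → ℝ) :=
  μ.restrict (stratum E)

/-- `μ` is of order `E`: `|μ|(A_E) > 0`, and `|μ|(A_F) = 0` for every `F ≠ E`. -/
def HasOrder (μ : SignedMeasure (Fin n → ℝ)) (E : Finset (Fin n)) : Prop :=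
  0 < μ.variation (stratum E) ∧ ∀ F, F ≠ E → μ.variation (stratum F) = 0

/-- The orthogonal projection of `ℝⁿ` onto the coordinate subspace `H_E`. -/
def proj (E : Finset (Fin n)) (x : Fin n → ℝ) : Fin n → ℝ := fun i => if i ∈ E then x i else 0

theorem measurable_proj (E : Finset (Fin n)) : Measurable (proj E) := by
  refine measurable_pi_lambda _ fun i => ?_
  by_cases hi : i ∈ E
  · simpa [proj, hi] using measurable_pi_apply i
  · simp [proj, hi]

/-- The marginal `P_E(μ) = μ ∘ P_E⁻¹`. -/
def projMeasure (E : Finset (Fin n)) (μ : SignedMeasure (Fin n → ℝ)) :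
    SignedMeasure (Fin n → ℝ) :=
  μ.map (proj E)

/-- The multiple reflection `T_E`, which changes the sign of the coordinates in `E`. -/
def reflect (E : Finset (Fin n)) (x : Fin n → ℝ) : Fin n → ℝ := fun i => if i ∈ E then -x i else x i

theorem measurable_reflect (E : Finset (Fin n)) : Measurable (reflect E) := by
  refine measurable_pi_lambda _ fun i => ?_
  by_cases hi : i ∈ E
  · simp only [reflect, hi, if_true]
    exact (measurable_pi_apply i).neg
  · simpa [reflect, hi] using measurable_pi_apply i

/-- `μ` is even under `T_F`. -/
def EvenUnder (F : Finset (Fin n)) (μ : SignedMeasure (Fin n → ℝ)) : Prop :=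
  μ.map (reflect F) = μ

/-- `μ` is odd under `T_F`. -/
def OddUnder (F : Finset (Fin n)) (μ : SignedMeasure (Fin n → ℝ)) : Prop :=
  μ.map (reflect F) = -μ

/-- `ℳ^int(A; 𝓕ₑ, 𝓕ₒ)`: the integrable measures concentrated on `A` that are even under all members
of `𝓕ₑ` and odd under all members of `𝓕ₒ`. -/
def symMeasures (A : Set (Fin n → ℝ)) (Fe Fo : Set (Finset (Fin n))) :
    Set (SignedMeasure (Fin n → ℝ)) :=
  {μ | IsIntegrable μ ∧ ConcentratedOn μ A ∧ (∀ F ∈ Fe, EvenUnder F μ) ∧ ∀ F ∈ Fo, OddUnder F μ}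

/-- `ν` is universal on `𝒜`. -/
def UniversalOn (ν : SignedMeasure (Fin n → ℝ)) (𝒜 : Set (SignedMeasure (Fin n → ℝ))) : Prop :=
  ∀ μ ∈ 𝒜, mulConv ν μ = 0 → μ = 0

/-- The symmetric difference `F₁ ∆ ⋯ ∆ Fₘ` of a finite list of sets (`∅` for the empty list). -/
def symmDiffList (L : List (Finset (Fin n))) : Finset (Fin n) := L.foldr symmDiff ∅

/-- The even part `𝒢ₑ` of the group (under symmetric difference) generated by `𝓕ₑ ∪ 𝓕ₒ`: all sets
that are a symmetric difference of members of `𝓕ₑ` and an even number of members of `𝓕ₒ`. -/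
def evenPart (Fe Fo : Set (Finset (Fin n))) : Set (Finset (Fin n)) :=
  {G | ∃ L M : List (Finset (Fin n)), (∀ F ∈ L, F ∈ Fe) ∧ (∀ F ∈ M, F ∈ Fo) ∧
    Even M.length ∧ G = symmDiffList (L ++ M)}

/-- The odd part `𝒢ₒ` of the group (under symmetric difference) generated by `𝓕ₑ ∪ 𝓕ₒ`: all sets
that are a symmetric difference of members of `𝓕ₑ` and an odd number of members of `𝓕ₒ`. -/
def oddPart (Fe Fo : Set (Finset (Fin n))) : Set (Finset (Fin n)) :=
  {G | ∃ L M : List (Finset (Fin n)), (∀ F ∈ L, F ∈ Fe) ∧ (∀ F ∈ M, F ∈ Fo) ∧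
    Odd M.length ∧ G = symmDiffList (L ++ M)}

/-- The generating pair `(𝓕ₑ, 𝓕ₒ)` is proper. -/
def IsProper (Fe Fo : Set (Finset (Fin n))) : Prop := evenPart Fe Fo ∩ oddPart Fe Fo = ∅

/-- `𝓕|_E = {F ∩ E : F ∈ 𝓕}`. -/
def restrictFamily (Fam : Set (Finset (Fin n))) (E : Finset (Fin n)) : Set (Finset (Fin n)) :=
  (fun F => F ∩ E) '' Fam

/-- `𝒥(E; 𝓕ₑ, 𝓕ₒ)`: all `J ⊆ E` such that `|J ∩ F|` is even for `F ∈ 𝓕ₑ` and odd for `F ∈ 𝓕ₒ`. -/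
def indexFamily (E : Finset (Fin n)) (Fe Fo : Set (Finset (Fin n))) : Set (Finset (Fin n)) :=
  {J | J ⊆ E ∧ (∀ F ∈ Fe, Even (J ∩ F).card) ∧ ∀ F ∈ Fo, Odd (J ∩ F).card}

/-- The sign vectors `s ∈ {-1, 0, 1}ⁿ` with `s_i ∈ {-1, 1}` for `i ∈ E` and `s_i = 0` otherwise. -/
def signVectors (E : Finset (Fin n)) : Finset (Fin n → SignType) :=
  {s | ∀ i, s i ≠ 0 ↔ i ∈ E}

/-- The atomic measure `δ_{E,J} = 2^{-|E|} ∑_s (∏_{j ∈ J} s_j) δ_s`, where `s` runs through the sign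
vectors of `E`. -/
def signDelta (E J : Finset (Fin n)) : SignedMeasure (Fin n → ℝ) :=
  ((2 : ℝ) ^ E.card)⁻¹ • ∑ s ∈ signVectors E,
    (∏ j ∈ J, ((s j : SignType) : ℝ)) • VectorMeasure.dirac (fun i => ((s i : SignType) : ℝ)) (1 : ℝ)

end

end MultConv

open MultConv

/-! The characters `mellinChar E J w`, that is `∏_{j ∈ J} sign x_j · ∏_{i ∈ E} |x_i| ^ w_i`, are
multiplicative, so the Mellin transform of `ν ⊛ μ` is the product of the two transforms. An
integrable measure has a transform for `0 < Re w_i ≤ 1 / n`, holomorphic inside. If `ν ⊛ μ = 0`,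
then for each `(E, J)` the transform of `ν` or that of `μ` vanishes on the line `Re w_i = 1 / (2n)`,
since analytic functions have no zero divisors (`mellin_eq_zero_or_eq_zero`).

In logarithmic coordinates such a vanishing is a Fourier statement. It says that the signed sum over
all reflections, with signs `(-1) ^ |J ∩ S|`, of the nondegenerate marginal `R_E P_E` is zero
(`reflectSum_eq_zero_of_mellin_eq_zero`). That sum is zero exactly when the convolution with `δ_J`
is, so the hypothesis on `ν` forces it to vanish for `μ`. If `J` is not in the index family, it
vanishes for `μ` by symmetry. Inversion over `J` gives `R_E P_E(μ) = 0` for every `E`, and hence `μ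
= 0` (`eq_zero_of_coordPart_projMeasure_eq_zero`).

Conversely, if the condition fails at `(E, J)`, a finite atomic measure of symmetry type `J` is
annihilated by `ν` (`discreteWitness`). Alternating signs make it blind to all of `ν` except `R_E
P_E(ν)`.

For `ν` of order `[n]`, restriction to strata is superfluous, and projecting from `E` to `J` shows
that `E = J` is the decisive case. The last claim is linear algebra over `𝔽₂`: if `G` is not in the
required part, some `J` in the index family meets `G` in the wrong parity
(`exists_mem_indexFamily`), and the symmetry of `P_E(ν)` under `T_G` violates the condition at `J`.
-/

namespace MultConv

variable {n : ℕ}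

/-! ### Integration against signed measures through the Jordan decomposition. -/

section SignedIntegral

variable {X Y : Type*} [MeasurableSpace X] [MeasurableSpace Y]

/-- The complex integral of a complex function against a signed measure. -/
noncomputable def signedIntegral (μ : SignedMeasure X) (f : X → ℂ) : ℂ := ∫ᵛ x, f x ∂<•μ

theorem posPart_le_variation (μ : SignedMeasure X) :
    μ.toJordanDecomposition.posPart ≤ μ.variation := by
  rw [← SignedMeasure.totalVariation_eq_variation]
  exact Measure.le_add_right le_rfl

theorem negPart_le_variation (μ : SignedMeasure X) :
    μ.toJordanDecomposition.negPart ≤ μ.variation := by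
  rw [← SignedMeasure.totalVariation_eq_variation]
  exact Measure.le_add_left le_rfl

theorem signedIntegral_toSignedMeasure_sub (a b : Measure X) [IsFiniteMeasure a]
    [IsFiniteMeasure b] {f : X → ℂ} (ha : Integrable f a) (hb : Integrable f b) :
    signedIntegral (a.toSignedMeasure - b.toSignedMeasure) f = ∫ x, f x ∂a - ∫ x, f x ∂b := by
  rw [signedIntegral, VectorMeasure.integral_sub_vectorMeasure,
    VectorMeasure.integral_toSignedMeasure, VectorMeasure.integral_toSignedMeasure]
  · simpa [VectorMeasure.Integrable] using ha
  · simpa [VectorMeasure.Integrable] using hb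

theorem eq_posPart_sub_negPart (μ : SignedMeasure X) :
    μ = μ.toJordanDecomposition.posPart.toSignedMeasure -
      μ.toJordanDecomposition.negPart.toSignedMeasure :=
  (SignedMeasure.toSignedMeasure_toJordanDecomposition μ).symm

theorem signedIntegral_eq_sub (μ : SignedMeasure X) {f : X → ℂ} (hf : μ.Integrable f) :
    signedIntegral μ f = ∫ x, f x ∂μ.toJordanDecomposition.posPart -
      ∫ x, f x ∂μ.toJordanDecomposition.negPart := by
  conv_lhs => rw [eq_posPart_sub_negPart μ]
  exact signedIntegral_toSignedMeasure_sub _ _ (hf.mono_measure (posPart_le_variation μ))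
    (hf.mono_measure (negPart_le_variation μ))

theorem prod_toSignedMeasure_sub (a b : Measure X) (c d : Measure Y) [IsFiniteMeasure a]
    [IsFiniteMeasure b] [IsFiniteMeasure c] [IsFiniteMeasure d] :
    VectorMeasure.prod (a.toSignedMeasure - b.toSignedMeasure)
      (c.toSignedMeasure - d.toSignedMeasure) (ContinuousLinearMap.lsmul ℝ ℝ).flip =
    (a.prod c + b.prod d).toSignedMeasure - (a.prod d + b.prod c).toSignedMeasure := by
  refine VectorMeasure.prod_eq_of_forall_apply_prod fun s t hs ht => ?_
  rw [Measure.toSignedMeasure_sub_apply (hs.prod ht)]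
  rw [measureReal_add_apply, measureReal_add_apply]
  simp only [measureReal_prod_prod, ContinuousLinearMap.flip_apply, ContinuousLinearMap.lsmul_apply,
    Measure.toSignedMeasure_sub_apply hs, Measure.toSignedMeasure_sub_apply ht, smul_eq_mul]
  ring

theorem signedIntegral_prod_mul (μ : SignedMeasure X) (ν : SignedMeasure Y) {f : X → ℂ}
    {g : Y → ℂ} (hf : μ.Integrable f) (hg : ν.Integrable g) :
    signedIntegral (VectorMeasure.prod μ ν (ContinuousLinearMap.lsmul ℝ ℝ).flip)
      (fun p => f p.1 * g p.2) = signedIntegral μ f * signedIntegral ν g := by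
  have h1 := hf.mono_measure (posPart_le_variation μ)
  have h2 := hf.mono_measure (negPart_le_variation μ)
  have h3 := hg.mono_measure (posPart_le_variation ν)
  have h4 := hg.mono_measure (negPart_le_variation ν)
  rw [signedIntegral_eq_sub μ hf, signedIntegral_eq_sub ν hg]
  conv_lhs => rw [eq_posPart_sub_negPart μ, eq_posPart_sub_negPart ν]
  rw [prod_toSignedMeasure_sub, signedIntegral_toSignedMeasure_sub,
    integral_add_measure (h1.mul_prod h3) (h2.mul_prod h4),
    integral_add_measure (h1.mul_prod h4) (h2.mul_prod h3)]
  · simp only [integral_prod_mul]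
    ring
  · exact (h1.mul_prod h3).add_measure (h2.mul_prod h4)
  · exact (h1.mul_prod h4).add_measure (h2.mul_prod h3)

theorem signedIntegral_map {μ : SignedMeasure X} {φ : X → Y} (hφ : Measurable φ) {f : Y → ℂ}
    (hf : Measurable f) (hi : μ.Integrable (f ∘ φ)) :
    signedIntegral (μ.map φ) f = signedIntegral μ (f ∘ φ) :=
  VectorMeasure.integral_map hφ hf.aestronglyMeasurable hi

theorem signedIntegral_indicator_one (μ : SignedMeasure X) {A : Set X} (hA : MeasurableSet A) :
    signedIntegral μ (A.indicator 1) = (μ A : ℂ) := by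
  rw [signedIntegral, VectorMeasure.integral_indicator hA]
  have := VectorMeasure.integral_const (μ := μ.restrict A)
    (B := (ContinuousLinearMap.lsmul ℝ ℝ (E := ℂ)).flip) (1 : ℂ)
  simp [this]

theorem map_map (μ : SignedMeasure X) {Z : Type*} [MeasurableSpace Z] {φ : X → Y} {ψ : Y → Z}
    (hφ : Measurable φ) (hψ : Measurable ψ) : (μ.map φ).map ψ = μ.map (ψ ∘ φ) := by
  ext A hA
  rw [VectorMeasure.map_apply _ hψ hA, VectorMeasure.map_apply _ hφ (hψ hA),
    VectorMeasure.map_apply _ (hψ.comp hφ) hA, Set.preimage_comp]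

theorem map_finsetSum {ι : Type*} (s : Finset ι) (μ : ι → SignedMeasure X) (φ : X → Y) :
    (∑ i ∈ s, μ i).map φ = ∑ i ∈ s, (μ i).map φ :=
  map_sum (VectorMeasure.mapGm φ) μ s

theorem map_dirac {φ : X → Y} (hφ : Measurable φ) (x : X) (c : ℝ) :
    (VectorMeasure.dirac x c).map φ = VectorMeasure.dirac (φ x) c := by
  ext A hA
  rw [VectorMeasure.map_apply _ hφ hA]
  by_cases h : φ x ∈ A
  · rw [VectorMeasure.dirac_apply_of_mem (hφ hA) h, VectorMeasure.dirac_apply_of_mem hA h]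
  · rw [VectorMeasure.dirac_apply_of_notMem h,
      VectorMeasure.dirac_apply_of_notMem (s := φ ⁻¹' A) h]

theorem finsetSum_apply {ι : Type*} (s : Finset ι) (μ : ι → SignedMeasure X) (A : Set X) :
    (∑ i ∈ s, μ i) A = ∑ i ∈ s, μ i A := by
  classical
  induction s using Finset.induction_on with
  | empty => simp
  | insert a s ha ih => rw [Finset.sum_insert ha, Finset.sum_insert ha, ← ih]; rfl

end SignedIntegral

/-! ### Multiplicative convolution against characters and against atoms. -/

section MulConv

theorem mulConv_apply' (μ ν : SignedMeasure (Fin n → ℝ)) {A : Set (Fin n → ℝ)}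
    (hA : MeasurableSet A) :
    mulConv μ ν A = ∫ᵛ x, ν.map (fun y => x * y) A ∂•μ := by
  have hm : Measurable fun p : (Fin n → ℝ) × (Fin n → ℝ) => p.1 * p.2 := by fun_prop
  rw [mulConv, VectorMeasure.map_apply _ hm hA, VectorMeasure.prod_apply_eq_integral (hm hA)]
  congr 1
  ext x
  rw [VectorMeasure.map_apply _ (by fun_prop) hA]
  rfl

theorem signedIntegral_mulConv (μ ν : SignedMeasure (Fin n → ℝ)) {f : (Fin n → ℝ) → ℂ}
    (hf : Measurable f) (hmul : ∀ x y, f (x * y) = f x * f y) (hμ : μ.Integrable f)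
    (hν : ν.Integrable f) :
    signedIntegral (mulConv μ ν) f = signedIntegral μ f * signedIntegral ν f := by
  have hm : Measurable fun p : (Fin n → ℝ) × (Fin n → ℝ) => p.1 * p.2 := by fun_prop
  have he : f ∘ (fun p : (Fin n → ℝ) × (Fin n → ℝ) => p.1 * p.2) =
      fun p => f p.1 * f p.2 := by
    ext p; exact hmul _ _
  rw [mulConv, signedIntegral_map hm hf, he, signedIntegral_prod_mul μ ν hμ hν]
  rw [he]
  -- The variation of the product is at most a constant times the product of the variations.
  have h : Integrable (fun p : (Fin n → ℝ) × (Fin n → ℝ) => f p.1 * f p.2)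
      (‖(ContinuousLinearMap.lsmul ℝ ℝ (E := ℝ)).flip‖₊ • μ.variation.prod ν.variation) :=
    (Integrable.mul_prod hμ hν).smul_measure_nnreal
  exact h.mono_measure VectorMeasure.variation_prod_le

theorem mulConv_sum_dirac_left {ι : Type*} (s : Finset ι) (c : ι → ℝ) (z : ι → Fin n → ℝ)
    (τ : SignedMeasure (Fin n → ℝ)) :
    mulConv (∑ i ∈ s, c i • VectorMeasure.dirac (z i) (1 : ℝ)) τ =
      ∑ i ∈ s, c i • τ.map fun y => z i * y := by
  have hm : Measurable fun p : (Fin n → ℝ) × (Fin n → ℝ) => p.1 * p.2 := by fun_prop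
  have hz : ∀ i, Measurable fun y : Fin n → ℝ => (z i, y) := fun i => by fun_prop
  have h : VectorMeasure.prod (∑ i ∈ s, c i • VectorMeasure.dirac (z i) (1 : ℝ)) τ
      (ContinuousLinearMap.lsmul ℝ ℝ).flip = ∑ i ∈ s, c i • τ.map fun y => (z i, y) := by
    refine VectorMeasure.prod_eq_of_forall_apply_prod fun A B hA hB => ?_
    rw [finsetSum_apply, finsetSum_apply, ContinuousLinearMap.flip_apply,
      ContinuousLinearMap.lsmul_apply, smul_eq_mul, Finset.mul_sum]
    refine Finset.sum_congr rfl fun i _ => ?_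
    rw [smul_apply, smul_apply,
      VectorMeasure.map_apply _ (hz i) (hA.prod hB)]
    by_cases hi : z i ∈ A
    · rw [VectorMeasure.dirac_apply_of_mem hA hi, Set.mk_preimage_prod_right hi]
      simp [mul_comm]
    · rw [VectorMeasure.dirac_apply_of_notMem hi, Set.mk_preimage_prod_right_eq_empty hi]
      simp
  rw [mulConv, h, map_finsetSum]
  refine Finset.sum_congr rfl fun i _ => ?_
  rw [VectorMeasure.map_smul, map_map _ (hz i) hm]
  rfl

end MulConv

/-! ### Characters of the reflection group `(ℤ/2)ⁿ`. -/

section Parity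

/-- The sign `(-1) ^ |J ∩ S|`. -/
noncomputable def paritySign (J S : Finset (Fin n)) : ℝ := ∏ j ∈ J, if j ∈ S then -1 else 1

theorem paritySign_symmDiff (J S T : Finset (Fin n)) :
    paritySign J (symmDiff S T) = paritySign J S * paritySign J T := by
  rw [paritySign, paritySign, paritySign, ← Finset.prod_mul_distrib]
  refine Finset.prod_congr rfl fun j _ => ?_
  by_cases hS : j ∈ S <;> by_cases hT : j ∈ T <;> simp [Finset.mem_symmDiff, hS, hT]

theorem paritySign_eq_pow (J S : Finset (Fin n)) : paritySign J S = (-1) ^ (J ∩ S).card := by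
  rw [paritySign, Finset.prod_ite, Finset.prod_const, Finset.prod_const_one, mul_one,
    Finset.filter_mem_eq_inter]

theorem paritySign_of_even {J S : Finset (Fin n)} (h : Even (J ∩ S).card) :
    paritySign J S = 1 := by rw [paritySign_eq_pow, h.neg_one_pow]

theorem paritySign_of_odd {J S : Finset (Fin n)} (h : Odd (J ∩ S).card) :
    paritySign J S = -1 := by rw [paritySign_eq_pow, h.neg_one_pow]

theorem paritySign_singleton {J : Finset (Fin n)} {i : Fin n} (hi : i ∈ J) :
    paritySign J {i} = -1 := by
  rw [paritySign_eq_pow, Finset.inter_singleton_of_mem hi]; simp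

@[simp] theorem paritySign_empty (J : Finset (Fin n)) : paritySign J ∅ = 1 := by
  simp [paritySign]

/-- Orthogonality of characters: the sum factors over coordinates, and any coordinate in `S` gives
the factor `1 - 1`. -/
theorem sum_paritySign (S : Finset (Fin n)) :
    ∑ J : Finset (Fin n), paritySign J S = if S = ∅ then (2 : ℝ) ^ n else 0 := by
  have h : ∑ J : Finset (Fin n), paritySign J S =
      ∏ j : Fin n, (1 + if j ∈ S then (-1 : ℝ) else 1) := by
    rw [Finset.prod_one_add, Finset.powerset_univ]
    rfl
  rw [h]
  split_ifs with hS
  · subst hS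
    simp only [Finset.notMem_empty, if_false, Finset.prod_const, Finset.card_univ,
      Fintype.card_fin]
    norm_num
  · obtain ⟨i, hi⟩ := Finset.nonempty_iff_ne_empty.2 hS
    exact Finset.prod_eq_zero (Finset.mem_univ i) (by simp [hi])

end Parity

/-! ### Reflections and projections as maps of `ℝⁿ`. -/

section Reflect

theorem reflect_comp_reflect (S T : Finset (Fin n)) :
    reflect S ∘ reflect T = reflect (symmDiff S T) := by
  ext x i
  by_cases hS : i ∈ S <;> by_cases hT : i ∈ T <;> simp [reflect, Finset.mem_symmDiff, hS, hT]

theorem reflect_empty : reflect (∅ : Finset (Fin n)) = id := by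
  ext x i; simp [reflect]

theorem reflect_mul (S : Finset (Fin n)) (x y : Fin n → ℝ) :
    reflect S (x * y) = reflect S x * y := by
  ext i; by_cases hS : i ∈ S <;> simp [reflect, hS]

theorem mul_reflect (S : Finset (Fin n)) (x y : Fin n → ℝ) :
    x * reflect S y = reflect S (x * y) := by
  rw [mul_comm x y, reflect_mul, mul_comm]

theorem proj_mul (E : Finset (Fin n)) (x y : Fin n → ℝ) : proj E (x * y) = proj E x * y := by
  ext i; by_cases hE : i ∈ E <;> simp [proj, hE]

theorem proj_comp_reflect (E S : Finset (Fin n)) : proj E ∘ reflect S = reflect S ∘ proj E := by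
  ext x i; by_cases hE : i ∈ E <;> by_cases hS : i ∈ S <;> simp [proj, reflect, hE, hS]

theorem proj_comp_proj {E F : Finset (Fin n)} (h : F ⊆ E) : proj F ∘ proj E = proj F := by
  ext x i
  by_cases hF : i ∈ F
  · simp [proj, hF, h hF]
  · simp [proj, hF]

theorem proj_univ : proj (Finset.univ : Finset (Fin n)) = id := by
  ext x i; simp [proj]

theorem reflect_mem_stratum {E S : Finset (Fin n)} {x : Fin n → ℝ} :
    reflect S x ∈ stratum E ↔ x ∈ stratum E := by
  refine forall_congr' fun i => ?_
  by_cases hS : i ∈ S <;> simp [reflect, hS]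

theorem proj_mem_stratum {E : Finset (Fin n)} {x : Fin n → ℝ} :
    proj E x ∈ stratum E ↔ ∀ i ∈ E, x i ≠ 0 := by
  refine forall_congr' fun i => ?_
  by_cases hE : i ∈ E <;> simp [proj, hE]

theorem proj_of_mem_stratum {E F : Finset (Fin n)} {x : Fin n → ℝ} (hx : x ∈ stratum F)
    (h : F ⊆ E) : proj E x = x := by
  ext i
  by_cases hE : i ∈ E
  · simp [proj, hE]
  · have := (hx i).not.2 fun hi => hE (h hi)
    simp only [ne_eq, not_not] at this
    simp [proj, hE, this]

end Reflect

/-! ### Signed sums over reflections, and their relation to `δ_{E,J}`. -/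

section ReflectSum

/-- The signed sum of all reflected images of `τ`, with signs given by the index set `J`. -/
noncomputable def reflectSum (J : Finset (Fin n)) (τ : SignedMeasure (Fin n → ℝ)) :
    SignedMeasure (Fin n → ℝ) :=
  ∑ S : Finset (Fin n), paritySign J S • τ.map (reflect S)

/-- A sign vector of `E` is encoded by the set `S ⊆ E` of its negative coordinates. -/
theorem signDelta_eq {E J : Finset (Fin n)} (h : J ⊆ E) :
    signDelta E J = ∑ S ∈ E.powerset, (((2 : ℝ) ^ E.card)⁻¹ * paritySign J S) •
      VectorMeasure.dirac (proj E (reflect S 1)) (1 : ℝ) := by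
  rw [signDelta, Finset.smul_sum]
  refine Finset.sum_nbij' (fun s => Finset.univ.filter fun i => s i = -1)
    (fun S i => if i ∈ S then -1 else if i ∈ E then 1 else 0) ?_ ?_ ?_ ?_ ?_
  · intro s hs
    simp only [signVectors, Finset.mem_filter, Finset.mem_univ, true_and] at hs
    rw [Finset.mem_powerset]
    intro i hi
    rw [Finset.mem_filter] at hi
    exact (hs i).1 (by rw [hi.2]; decide)
  · intro S hS
    rw [Finset.mem_powerset] at hS
    simp only [signVectors, Finset.mem_filter, Finset.mem_univ, true_and]
    intro i
    by_cases hiS : i ∈ S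
    · simp [hiS, hS hiS]
    · by_cases hiE : i ∈ E <;> simp [hiS, hiE]
  · intro s hs
    simp only [signVectors, Finset.mem_filter, Finset.mem_univ, true_and] at hs
    ext1 i
    have := hs i
    rcases hsi : s i with _ | _ | _ <;> simp_all
  · intro S hS
    ext i
    by_cases hiS : i ∈ S
    · simp [hiS]
    · by_cases hiE : i ∈ E <;> simp [hiS, hiE]
  · intro s hs
    simp only [signVectors, Finset.mem_filter, Finset.mem_univ, true_and] at hs
    have h1 : (∏ j ∈ J, ((s j : SignType) : ℝ)) =
        paritySign J (Finset.univ.filter fun i => s i = -1) := by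
      refine Finset.prod_congr rfl fun j hj => ?_
      have := (hs j).2 (h hj)
      rcases hsj : s j with _ | _ | _ <;> simp_all
    have h2 : (fun i => ((s i : SignType) : ℝ)) =
        proj E (reflect (Finset.univ.filter fun i => s i = -1) 1) := by
      ext i
      have := hs i
      rcases hsi : s i with _ | _ | _ <;> simp_all [proj, reflect]
    rw [h1, h2, smul_smul]

theorem mulConv_signDelta {E J : Finset (Fin n)} (h : J ⊆ E) (τ : SignedMeasure (Fin n → ℝ)) :
    mulConv (signDelta E J) τ = ((2 : ℝ) ^ E.card)⁻¹ •
      ∑ S ∈ E.powerset, paritySign J S • τ.map (proj E ∘ reflect S) := by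
  rw [signDelta_eq h, mulConv_sum_dirac_left, Finset.smul_sum]
  refine Finset.sum_congr rfl fun S _ => ?_
  rw [smul_smul]
  congr 2
  ext1 y
  rw [← proj_mul, ← reflect_mul, one_mul]
  rfl

theorem mulConv_signDelta_eq_zero_iff {E J : Finset (Fin n)} (h : J ⊆ E)
    (τ : SignedMeasure (Fin n → ℝ)) : mulConv (signDelta E J) τ = 0 ↔
      ∑ S ∈ E.powerset, paritySign J S • τ.map (proj E ∘ reflect S) = 0 := by
  rw [mulConv_signDelta h, smul_eq_zero_iff_right]
  positivity

theorem mulConv_signDelta_univ_eq_zero_iff (J : Finset (Fin n))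
    (τ : SignedMeasure (Fin n → ℝ)) :
    mulConv (signDelta Finset.univ J) τ = 0 ↔ reflectSum J τ = 0 := by
  rw [mulConv_signDelta_eq_zero_iff (Finset.subset_univ J), Finset.powerset_univ, proj_univ]
  rfl

/-- Substitution `S ↦ S ∆ G` in the group of reflections. -/
theorem reflectSum_reindex (J G : Finset (Fin n)) (τ : SignedMeasure (Fin n → ℝ)) :
    reflectSum J τ = paritySign J G • reflectSum J (τ.map (reflect G)) := by
  rw [reflectSum, reflectSum, Finset.smul_sum]
  refine (Fintype.sum_equiv (symmDiff_left_involutive G).toPerm _ _ fun S => ?_).symm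
  rw [Function.Involutive.coe_toPerm, map_map _ (measurable_reflect G) (measurable_reflect S),
    reflect_comp_reflect, paritySign_symmDiff, smul_smul, mul_comm]

theorem reflectSum_smul (J : Finset (Fin n)) (θ : ℝ) (τ : SignedMeasure (Fin n → ℝ)) :
    reflectSum J (θ • τ) = θ • reflectSum J τ := by
  rw [reflectSum, reflectSum, Finset.smul_sum]
  refine Finset.sum_congr rfl fun S _ => ?_
  rw [VectorMeasure.map_smul, smul_comm]

/-- A symmetry whose sign disagrees with the character `J` makes the sum equal to its own negative.
-/
theorem reflectSum_eq_zero_of_map_eq_smul {J G : Finset (Fin n)} {θ : ℝ}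
    {τ : SignedMeasure (Fin n → ℝ)} (h : τ.map (reflect G) = θ • τ)
    (hθ : paritySign J G * θ = -1) : reflectSum J τ = 0 := by
  have := reflectSum_reindex J G τ
  rw [h, reflectSum_smul, smul_smul, hθ, neg_one_smul, eq_neg_iff_add_eq_zero,
    ← two_smul ℝ] at this
  exact (smul_eq_zero.1 this).resolve_left two_ne_zero

/-- Fourier inversion on `(ℤ/2)ⁿ`: summing over all `J` leaves only `S = ∅`, with weight `2 ^ n`. -/
theorem eq_zero_of_reflectSum_eq_zero {τ : SignedMeasure (Fin n → ℝ)}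
    (h : ∀ J, reflectSum J τ = 0) : τ = 0 := by
  have h1 : ∑ J : Finset (Fin n), reflectSum J τ = (2 : ℝ) ^ n • τ := by
    simp only [reflectSum]
    rw [Finset.sum_comm]
    simp only [← Finset.sum_smul, sum_paritySign, ite_smul, zero_smul]
    rw [Finset.sum_ite_eq' Finset.univ ∅ fun S => (2 : ℝ) ^ n • τ.map (reflect S)]
    simp [reflect_empty]
  rw [Finset.sum_eq_zero fun J _ => h J] at h1
  exact (smul_eq_zero.1 h1.symm).resolve_left (by positivity)

end ReflectSum

/-! ### Strata and marginals. -/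

section CoordPart

theorem coordPart_projMeasure_map_reflect (E F : Finset (Fin n)) (μ : SignedMeasure (Fin n → ℝ)) :
    (coordPart E (projMeasure E μ)).map (reflect F) =
      coordPart E (projMeasure E (μ.map (reflect F))) := by
  have h : reflect F ⁻¹' stratum E = stratum E := by
    ext x; exact reflect_mem_stratum
  rw [projMeasure, projMeasure, coordPart, coordPart,
    map_map _ (measurable_reflect F) (measurable_proj E), proj_comp_reflect,
    ← map_map _ (measurable_proj E) (measurable_reflect F),
    VectorMeasure.restrict_map _ (measurable_reflect F) (measurableSet_stratum E), h]

theorem projMeasure_map_reflect (E F : Finset (Fin n)) (μ : SignedMeasure (Fin n → ℝ)) :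
    (projMeasure E μ).map (reflect F) = projMeasure E (μ.map (reflect F)) := by
  rw [projMeasure, projMeasure, map_map _ (measurable_reflect F) (measurable_proj E),
    proj_comp_reflect, ← map_map _ (measurable_proj E) (measurable_reflect F)]

theorem coordPart_smul (E : Finset (Fin n)) (θ : ℝ) (μ : SignedMeasure (Fin n → ℝ)) :
    coordPart E (θ • μ) = θ • coordPart E μ := VectorMeasure.restrict_smul _

theorem projMeasure_smul (E : Finset (Fin n)) (θ : ℝ) (μ : SignedMeasure (Fin n → ℝ)) :
    projMeasure E (θ • μ) = θ • projMeasure E μ := VectorMeasure.map_smul _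

/-- The marginal lives where `x_i = 0`. This invariance disposes of every `J` not contained in `E`.
-/
theorem coordPart_projMeasure_map_reflect_self {E : Finset (Fin n)} {i : Fin n} (hi : i ∉ E)
    (μ : SignedMeasure (Fin n → ℝ)) :
    (coordPart E (projMeasure E μ)).map (reflect {i}) = coordPart E (projMeasure E μ) := by
  have h : reflect {i} ∘ proj E = proj E := by
    ext x j
    by_cases hj : j = i
    · subst hj; simp [reflect, proj, hi]
    · simp [reflect, hj]
  rw [coordPart_projMeasure_map_reflect, projMeasure, projMeasure,
    map_map _ (measurable_reflect _) (measurable_proj E), proj_comp_reflect, h]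

theorem sum_coordPart (μ : SignedMeasure (Fin n → ℝ)) :
    ∑ F : Finset (Fin n), coordPart F μ = μ := by
  ext B hB
  have hU : B = ⋃ F ∈ (Finset.univ : Finset (Finset (Fin n))), B ∩ stratum F := by
    ext x
    simp only [Finset.mem_univ, Set.iUnion_true, Set.mem_iUnion, Set.mem_inter_iff]
    refine ⟨fun hx => ⟨Finset.univ.filter fun i => x i ≠ 0, hx, fun i => by simp⟩, ?_⟩
    rintro ⟨F, hx, -⟩
    exact hx
  conv_rhs => rw [hU]
  rw [VectorMeasure.of_biUnion_finset, finsetSum_apply]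
  · exact Finset.sum_congr rfl fun F _ => VectorMeasure.restrict_apply _ (measurableSet_stratum F) hB
  · intro F _ G _ hFG
    refine Set.disjoint_left.2 fun x hF hG => hFG ?_
    ext i
    rw [← hF.2 i, hG.2 i]
  · exact fun F _ => hB.inter (measurableSet_stratum F)

/-- A signed measure all of whose nondegenerate marginals vanish is zero. -/
theorem eq_zero_of_coordPart_projMeasure_eq_zero {μ : SignedMeasure (Fin n → ℝ)}
    (h : ∀ E, coordPart E (projMeasure E μ) = 0) : μ = 0 := by
  have key : ∀ E, coordPart E μ = 0 := by
    intro E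
    -- Downward induction from `[n]`: only strata `F ⊇ E` project onto the stratum of `E`, and those
    -- with `F ≠ E` are already known to carry no mass.
    induction E using WellFoundedGT.induction with
    | _ E ih =>
    ext A hA
    have hAE := hA.inter (measurableSet_stratum E)
    have hB := measurable_proj E hAE
    have h0 : μ (proj E ⁻¹' (A ∩ stratum E)) = 0 := by
      have := congrArg (fun τ : SignedMeasure (Fin n → ℝ) => τ A) (h E)
      rwa [coordPart, VectorMeasure.restrict_apply _ (measurableSet_stratum E) hA, projMeasure,
        VectorMeasure.map_apply _ (measurable_proj E) hAE] at this
    rw [← sum_coordPart μ, finsetSum_apply, Finset.sum_eq_single_of_mem E (Finset.mem_univ E)] at h0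
    · rw [coordPart, VectorMeasure.restrict_apply _ (measurableSet_stratum E) hB] at h0
      rw [coordPart, VectorMeasure.restrict_apply _ (measurableSet_stratum E) hA]
      refine (congrArg μ ?_).trans h0
      ext x
      simp only [Set.mem_inter_iff, Set.mem_preimage]
      constructor
      · rintro ⟨hx, hE⟩
        rw [proj_of_mem_stratum hE subset_rfl]
        exact ⟨⟨hx, hE⟩, hE⟩
      · rintro ⟨⟨hx, -⟩, hE⟩
        rw [proj_of_mem_stratum hE subset_rfl] at hx
        exact ⟨hx, hE⟩
    · intro F _ hF
      by_cases hEF : E ⊆ F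
      · rw [ih F (hEF.lt_of_ne' hF)]; rfl
      · obtain ⟨i, hiE, hiF⟩ := Finset.not_subset.1 hEF
        rw [coordPart, VectorMeasure.restrict_apply _ (measurableSet_stratum F) hB]
        convert μ.empty
        refine Set.eq_empty_of_forall_notMem fun x hx => hiF ?_
        exact (hx.2 i).1 (proj_mem_stratum.1 hx.1.2 i hiE)
  rw [← sum_coordPart μ, Finset.sum_eq_zero fun E _ => key E]

end CoordPart

/-! ### Mellin characters: multiplicativity, integrability, holomorphy. -/

section MellinChar

/-- The product of the signs of the coordinates in `J`, which is zero if one of them vanishes. -/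
noncomputable def coordSign (J : Finset (Fin n)) (x : Fin n → ℝ) : ℝ := ∏ j ∈ J, x j / |x j|

theorem measurable_coordSign (J : Finset (Fin n)) : Measurable (coordSign J) := by
  unfold coordSign; fun_prop

theorem coordSign_mul (J : Finset (Fin n)) (x y : Fin n → ℝ) :
    coordSign J (x * y) = coordSign J x * coordSign J y := by
  simp only [coordSign, ← Finset.prod_mul_distrib, Pi.mul_apply, abs_mul, mul_div_mul_comm]

theorem abs_coordSign_le_one (J : Finset (Fin n)) (x : Fin n → ℝ) : |coordSign J x| ≤ 1 := by
  rw [coordSign, Finset.abs_prod]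
  refine Finset.prod_le_one (fun _ _ => abs_nonneg _) fun j _ => ?_
  rw [abs_div, abs_abs]
  exact div_self_le_one _

/-- The multiplicative character `∏_{j ∈ J} sign x_j · ∏_{i ∈ E} |x_i| ^ w_i`. -/
noncomputable def mellinChar (E J : Finset (Fin n)) (w : Fin n → ℂ) (x : Fin n → ℝ) : ℂ :=
  (coordSign J x : ℂ) * ∏ i ∈ E, ((|x i| : ℝ) : ℂ) ^ w i

theorem measurable_mellinChar (E J : Finset (Fin n)) (w : Fin n → ℂ) :
    Measurable (mellinChar E J w) := by
  have := measurable_coordSign J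
  unfold mellinChar; fun_prop

theorem mellinChar_mul (E J : Finset (Fin n)) (w : Fin n → ℂ) (x y : Fin n → ℝ) :
    mellinChar E J w (x * y) = mellinChar E J w x * mellinChar E J w y := by
  have h : ∏ i ∈ E, ((|(x * y) i| : ℝ) : ℂ) ^ w i =
      (∏ i ∈ E, ((|x i| : ℝ) : ℂ) ^ w i) * ∏ i ∈ E, ((|y i| : ℝ) : ℂ) ^ w i := by
    rw [← Finset.prod_mul_distrib]
    refine Finset.prod_congr rfl fun i _ => ?_
    rw [Pi.mul_apply, abs_mul, Complex.ofReal_mul,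
      Complex.mul_cpow_ofReal_nonneg (abs_nonneg _) (abs_nonneg _)]
  rw [mellinChar, h, coordSign_mul, mellinChar, mellinChar]
  push_cast
  ring

theorem norm_mellinChar_le {E J : Finset (Fin n)} {w : Fin n → ℂ} (hw : ∀ i, 0 < (w i).re)
    (x : Fin n → ℝ) : ‖mellinChar E J w x‖ ≤ ∏ i ∈ E, |x i| ^ (w i).re := by
  rw [mellinChar, norm_mul, Complex.norm_real, Real.norm_eq_abs, norm_prod]
  have h : ∏ i ∈ E, ‖((|x i| : ℝ) : ℂ) ^ w i‖ = ∏ i ∈ E, |x i| ^ (w i).re :=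
    Finset.prod_congr rfl fun i _ =>
      Complex.norm_cpow_eq_rpow_re_of_nonneg (abs_nonneg _) (hw i).ne'
  rw [h]
  exact mul_le_of_le_one_left (Finset.prod_nonneg fun i _ => by positivity)
    (abs_coordSign_le_one J x)

/-- There are at most `n` factors, each bounded by `M ^ (1 / n)`. This bound is how the first moment
controls all characters in the strip. -/
theorem prod_abs_rpow_le (E : Finset (Fin n)) {r : Fin n → ℝ} (h0 : ∀ i, 0 < r i)
    (h1 : ∀ i, r i ≤ 1 / n) (x : Fin n → ℝ) :
    ∏ i ∈ E, |x i| ^ r i ≤ 1 + ‖WithLp.toLp 2 x‖ := by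
  set M := 1 + ‖WithLp.toLp 2 x‖ with hM
  have hM1 : 1 ≤ M := by simp [hM]
  have hx : ∀ i, |x i| ≤ M := fun i => by
    have := PiLp.norm_apply_le (WithLp.toLp 2 x) i
    rw [Real.norm_eq_abs] at this
    linarith
  rcases Nat.eq_zero_or_pos n with rfl | hn
  · simpa [Finset.eq_empty_of_isEmpty E] using hM1
  calc ∏ i ∈ E, |x i| ^ r i ≤ ∏ _i ∈ E, M ^ (1 / n : ℝ) := by
        refine Finset.prod_le_prod (fun i _ => by positivity) fun i _ => ?_
        exact (Real.rpow_le_rpow (abs_nonneg _) (hx i) (h0 i).le).trans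
          (Real.rpow_le_rpow_of_exponent_le hM1 (h1 i))
    _ = (M ^ (1 / n : ℝ)) ^ E.card := by rw [Finset.prod_const]
    _ ≤ (M ^ (1 / n : ℝ)) ^ n := by
        refine pow_le_pow_right₀ (Real.one_le_rpow hM1 (by positivity)) ?_
        simpa using E.card_le_univ
    _ = M := by
        rw [← Real.rpow_natCast, ← Real.rpow_mul (by linarith), one_div_mul_cancel, Real.rpow_one]
        positivity

theorem integrable_mellinChar {μ : SignedMeasure (Fin n → ℝ)} (hμ : IsIntegrable μ)
    {E J : Finset (Fin n)} {w : Fin n → ℂ} (h0 : ∀ i, 0 < (w i).re) (h1 : ∀ i, (w i).re ≤ 1 / n) :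
    μ.Integrable (mellinChar E J w) := by
  have hb : Integrable (fun x => 1 + ‖WithLp.toLp 2 x‖) μ.variation :=
    (integrable_const (1 : ℝ)).add hμ
  exact hb.mono' (measurable_mellinChar E J w).aestronglyMeasurable
    (Filter.Eventually.of_forall fun x =>
      (norm_mellinChar_le h0 x).trans (prod_abs_rpow_le E h0 h1 x))

/-- Laplace transforms with an exponentially integrable density are holomorphic in a strip. -/
theorem differentiableOn_integral_mul_cexp {X : Type*} [MeasurableSpace X] {m : Measure X}
    {g : X → ℂ} {Y B : X → ℝ} {r : ℝ} (hg : Measurable g) (hY : Measurable Y)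
    (hB : Integrable B m) (hgB : ∀ x, ‖g x‖ * Real.exp (r * |Y x|) ≤ B x) :
    DifferentiableOn ℂ (fun ζ => ∫ x, g x * Complex.exp (ζ * Y x) ∂m) {ζ | |ζ.re| < r} := by
  intro ζ hζ
  rw [Set.mem_ofPred_eq] at hζ
  -- Half the distance to the edge of the strip: the spare factor `e ^ (δ |Y|)` absorbs the `|Y|`
  -- produced by differentiation.
  set δ := (r - |ζ.re|) / 2 with hδ
  have hδ0 : 0 < δ := by rw [hδ]; linarith
  have hexp : ∀ z ∈ Metric.ball ζ δ, ∀ x, ‖Complex.exp (z * Y x)‖ ≤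
      Real.exp ((r - δ) * |Y x|) := by
    intro z hz x
    have h1 : |z.re| ≤ r - δ := by
      have h2 : |z.re - ζ.re| ≤ ‖z - ζ‖ := by
        rw [← Complex.sub_re]; exact Complex.abs_re_le_norm _
      have h3 : ‖z - ζ‖ < δ := by rwa [← dist_eq_norm]
      have h4 := abs_sub_abs_le_abs_sub z.re ζ.re
      linarith
    rw [Complex.norm_exp, Complex.re_mul_ofReal]
    refine Real.exp_le_exp.2 ((le_abs_self _).trans ?_)
    rw [abs_mul]
    exact mul_le_mul_of_nonneg_right h1 (abs_nonneg _)
  have hmeas : ∀ z : ℂ, Measurable fun x => g x * Complex.exp (z * Y x) := fun z => by fun_prop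
  have hζball : ζ ∈ Metric.ball ζ δ := Metric.mem_ball_self hδ0
  have h := hasDerivAt_integral_of_dominated_loc_of_deriv_le (μ := m) (𝕜 := ℂ)
    (F := fun z x => g x * Complex.exp (z * Y x))
    (F' := fun z x => g x * (Complex.exp (z * Y x) * Y x)) (x₀ := ζ) (bound := fun x => B x / δ)
    (Metric.ball_mem_nhds ζ hδ0) (Filter.Eventually.of_forall fun z => (hmeas z).aestronglyMeasurable)
    ?_ (by fun_prop) (Filter.Eventually.of_forall fun x z hz => ?_) (hB.div_const δ)
    (Filter.Eventually.of_forall fun x z _ => ?_)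
  · exact h.2.differentiableAt.differentiableWithinAt
  · refine hB.mono' (hmeas ζ).aestronglyMeasurable (Filter.Eventually.of_forall fun x => ?_)
    rw [norm_mul]
    refine (mul_le_mul_of_nonneg_left ((hexp ζ hζball x).trans ?_) (norm_nonneg _)).trans (hgB x)
    exact Real.exp_le_exp.2 (mul_le_mul_of_nonneg_right (by linarith) (abs_nonneg _))
  · rw [norm_mul, norm_mul, Complex.norm_real, Real.norm_eq_abs, le_div_iff₀ hδ0]
    refine le_trans ?_ (hgB x)
    rw [mul_assoc]
    refine mul_le_mul_of_nonneg_left ?_ (norm_nonneg _)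
    have h5 : |Y x| * δ ≤ Real.exp (δ * |Y x|) := by
      have := Real.add_one_le_exp (δ * |Y x|)
      linarith [mul_comm |Y x| δ]
    calc ‖Complex.exp (z * Y x)‖ * |Y x| * δ = ‖Complex.exp (z * Y x)‖ * (|Y x| * δ) := by ring
      _ ≤ Real.exp ((r - δ) * |Y x|) * Real.exp (δ * |Y x|) := by
          gcongr
          exact hexp z hz x
      _ = Real.exp (r * |Y x|) := by rw [← Real.exp_add]; ring_nf
  · have h6 : HasDerivAt (fun z : ℂ => z * (Y x : ℂ)) (Y x) z := by
      simpa using (hasDerivAt_id z).mul_const (Y x : ℂ)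
    exact h6.cexp.const_mul (g x)

end MellinChar

/-! ### Vanishing of a product of Mellin transforms. -/

section Dichotomy

/-- The exponents must be non-zero because `0 ^ 0 = 1`; then both sides vanish when some coordinate
in `E` does, whatever the value of `log 0`. -/
theorem mellinChar_add {E J : Finset (Fin n)} {w : Fin n → ℂ} {d : Fin n → ℝ} {ζ : ℂ}
    (hw : ∀ i, w i ≠ 0) (hwd : ∀ i, w i + ζ * d i ≠ 0) (x : Fin n → ℝ) :
    mellinChar E J (fun i => w i + ζ * d i) x =
      mellinChar E J w x * Complex.exp (ζ * (∑ i ∈ E, d i * Real.log |x i| : ℝ)) := by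
  rw [mellinChar, mellinChar, mul_assoc]
  congr 1
  by_cases hx : ∃ i ∈ E, x i = 0
  · obtain ⟨i, hi, hxi⟩ := hx
    rw [Finset.prod_eq_zero hi, Finset.prod_eq_zero hi, zero_mul]
    · simp [hxi, Complex.zero_cpow (hw i)]
    · simp [hxi, Complex.zero_cpow (hwd i)]
  · push Not at hx
    rw [Complex.ofReal_sum, Finset.mul_sum, Complex.exp_sum, ← Finset.prod_mul_distrib]
    refine Finset.prod_congr rfl fun i hi => ?_
    have h0 : ((|x i| : ℝ) : ℂ) ≠ 0 := by exact_mod_cast (abs_pos.2 (hx i hi)).ne'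
    rw [Complex.cpow_add _ _ h0, Complex.cpow_def_of_ne_zero h0 (ζ * d i),
      ← Complex.ofReal_log (abs_nonneg _)]
    congr 2
    push_cast
    ring

/-- The points `c + i t` of the vertical line with `c = 1 / (2 n)`. -/
noncomputable def lineExponent (t : Fin n → ℝ) (i : Fin n) : ℂ :=
  ((1 / (2 * n) : ℝ) : ℂ) + Complex.I * t i

theorem lineExponent_re (t : Fin n → ℝ) (i : Fin n) : (lineExponent t i).re = 1 / (2 * n) := by
  rw [lineExponent, Complex.add_re, Complex.ofReal_re, Complex.re_mul_ofReal]
  simp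

theorem differentiableOn_mellin {μ : SignedMeasure (Fin n → ℝ)} (hμ : IsIntegrable μ)
    (E J : Finset (Fin n)) (t d : Fin n → ℝ) {r : ℝ} (hr : 0 < r)
    (hrd : ∀ i, r * |d i| < 1 / (2 * n)) :
    DifferentiableOn ℂ (fun ζ => signedIntegral μ
      (mellinChar E J fun i => lineExponent t i + ζ * d i)) {ζ | |ζ.re| < r} := by
  set Y : (Fin n → ℝ) → ℝ := fun x => ∑ i ∈ E, d i * Real.log |x i| with hYdef
  have hY : Measurable Y := by fun_prop
  have hre : ∀ ζ : ℂ, |ζ.re| ≤ r → ∀ i, 0 < (lineExponent t i + ζ * d i).re ∧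
      (lineExponent t i + ζ * d i).re ≤ 1 / n := by
    intro ζ hζ i
    rw [Complex.add_re, lineExponent_re, Complex.re_mul_ofReal]
    have h1 : |ζ.re * d i| < 1 / (2 * n) := by
      rw [abs_mul]
      exact (mul_le_mul_of_nonneg_right hζ (abs_nonneg _)).trans_lt (hrd i)
    have h2 : (1 / n : ℝ) = 1 / (2 * n) + 1 / (2 * n) := by ring
    rw [abs_lt] at h1
    constructor <;> linarith
  have hne : ∀ ζ : ℂ, |ζ.re| ≤ r → ∀ i, lineExponent t i + ζ * d i ≠ 0 := fun ζ hζ i h => by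
    have := (hre ζ hζ i).1
    rw [h] at this
    simp at this
  have hne0 : ∀ i, lineExponent t i ≠ 0 := fun i => by
    simpa using hne 0 (by simpa using hr.le) i
  have hadd : ∀ ζ : ℂ, |ζ.re| ≤ r → ∀ x, mellinChar E J (fun i => lineExponent t i + ζ * d i) x =
      mellinChar E J (lineExponent t) x * Complex.exp (ζ * Y x) := fun ζ hζ x =>
    mellinChar_add hne0 (hne ζ hζ) x
  have hbound : ∀ ζ : ℂ, |ζ.re| ≤ r → ∀ x,
      ‖mellinChar E J (lineExponent t) x‖ * Real.exp (ζ.re * Y x) ≤ 1 + ‖WithLp.toLp 2 x‖ := by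
    intro ζ hζ x
    have h3 : Real.exp (ζ.re * Y x) = ‖Complex.exp (ζ * Y x)‖ := by
      rw [Complex.norm_exp, Complex.re_mul_ofReal]
    rw [h3, ← norm_mul, ← hadd ζ hζ x]
    exact (norm_mellinChar_le (fun i => (hre ζ hζ i).1) x).trans
      (prod_abs_rpow_le E (fun i => (hre ζ hζ i).1) (fun i => (hre ζ hζ i).2) x)
  -- `e ^ (r |Y|)` is `e ^ (± r Y)`, so the bound is that of the character at the two edges `ζ = ±
  -- r`, which remain admissible since `hrd` is strict.
  have hgB : ∀ x, ‖mellinChar E J (lineExponent t) x‖ * Real.exp (r * |Y x|) ≤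
      1 + ‖WithLp.toLp 2 x‖ := by
    intro x
    rcases abs_cases (Y x) with ⟨h, -⟩ | ⟨h, -⟩
    · rw [h]
      simpa using hbound (r : ℂ) (by simp [abs_of_pos hr]) x
    · rw [h]
      simpa using hbound (-r : ℂ) (by simp [abs_of_pos hr]) x
  have hb : Integrable (fun x => 1 + ‖WithLp.toLp 2 x‖) μ.variation :=
    (integrable_const (1 : ℝ)).add hμ
  refine DifferentiableOn.congr (f := fun ζ =>
    ∫ x, mellinChar E J (lineExponent t) x * Complex.exp (ζ * Y x)
      ∂μ.toJordanDecomposition.posPart -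
    ∫ x, mellinChar E J (lineExponent t) x * Complex.exp (ζ * Y x)
      ∂μ.toJordanDecomposition.negPart) ?_ ?_
  · exact (differentiableOn_integral_mul_cexp (measurable_mellinChar _ _ _) hY
      (hb.mono_measure (posPart_le_variation μ)) hgB).sub
      (differentiableOn_integral_mul_cexp (measurable_mellinChar _ _ _) hY
      (hb.mono_measure (negPart_le_variation μ)) hgB)
  · intro ζ hζ
    have hζ' : |ζ.re| ≤ r := le_of_lt hζ
    rw [signedIntegral_eq_sub μ (integrable_mellinChar hμ (fun i => (hre ζ hζ' i).1)
      fun i => (hre ζ hζ' i).2)]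
    simp only [hadd ζ hζ']

/-- If the multiplicative convolution of two integrable measures vanishes, then the Mellin
transform of one of them vanishes, separately for each character type. -/
theorem mellin_eq_zero_or_eq_zero {μ ν : SignedMeasure (Fin n → ℝ)} (hμ : IsIntegrable μ)
    (hν : IsIntegrable ν) (h : mulConv ν μ = 0) (E J : Finset (Fin n)) :
    (∀ t, signedIntegral ν (mellinChar E J (lineExponent t)) = 0) ∨
      ∀ t, signedIntegral μ (mellinChar E J (lineExponent t)) = 0 := by
  by_contra hcon
  push Not at hcon
  obtain ⟨⟨t₀, h₀⟩, t₁, h₁⟩ := hcon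
  rcases Nat.eq_zero_or_pos n with rfl | hn
  · have hmul := signedIntegral_mulConv ν μ (measurable_mellinChar E J (lineExponent t₀))
      (mellinChar_mul E J _) (integrable_mellinChar hν (fun i => i.elim0) fun i => i.elim0)
      (integrable_mellinChar hμ (fun i => i.elim0) fun i => i.elim0)
    rw [h, signedIntegral, VectorMeasure.integral_zero_vectorMeasure,
      Subsingleton.elim t₀ t₁] at hmul
    rw [Subsingleton.elim t₀ t₁] at h₀
    exact mul_ne_zero h₀ h₁ hmul.symm
  -- Reduction to one complex variable: the complex line with direction `d` passes through `t₀` at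
  -- `ζ = 0` and through `t₁` at `ζ = i`. The strip is taken narrow enough to keep all real parts in
  -- `(0, 1 / n)`.
  set d : Fin n → ℝ := t₁ - t₀ with hd
  set K : ℝ := 1 + ∑ i, |d i| with hK
  have hdK : ∀ i, |d i| < K := fun i => by
    have := Finset.single_le_sum (fun i _ => abs_nonneg (d i)) (Finset.mem_univ i)
    linarith
  have hK0 : 0 < K := by positivity
  have hc : (0 : ℝ) < 1 / (2 * n) := by positivity
  set r : ℝ := 1 / (2 * n) / K with hr
  have hr0 : 0 < r := by positivity
  have hrd : ∀ i, r * |d i| < 1 / (2 * n) := fun i => by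
    rw [hr, div_mul_eq_mul_div, div_lt_iff₀ hK0]
    exact mul_lt_mul_of_pos_left (hdK i) hc
  have hopen : IsOpen {ζ : ℂ | |ζ.re| < r} :=
    isOpen_lt (by fun_prop) continuous_const
  have hconv : IsPreconnected {ζ : ℂ | |ζ.re| < r} := by
    have : {ζ : ℂ | |ζ.re| < r} = Complex.reLm ⁻¹' Set.Ioo (-r) r := by
      ext ζ; simp [abs_lt]
    rw [this]
    exact ((convex_Ioo (-r) r).linear_preimage Complex.reLm).isPreconnected
  have hf := (differentiableOn_mellin hν E J t₀ d hr0 hrd).analyticOnNhd hopen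
  have hg := (differentiableOn_mellin hμ E J t₀ d hr0 hrd).analyticOnNhd hopen
  have hz : ∀ ζ ∈ {ζ : ℂ | |ζ.re| < r},
      signedIntegral ν (mellinChar E J fun i => lineExponent t₀ i + ζ * d i) *
        signedIntegral μ (mellinChar E J fun i => lineExponent t₀ i + ζ * d i) = 0 := by
    intro ζ hζ
    have hre : ∀ i, 0 < (lineExponent t₀ i + ζ * d i).re ∧
        (lineExponent t₀ i + ζ * d i).re ≤ 1 / n := by
      intro i
      rw [Complex.add_re, lineExponent_re, Complex.re_mul_ofReal]
      have h1 : |ζ.re * d i| < 1 / (2 * n) := by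
        rw [abs_mul]
        exact (mul_le_mul_of_nonneg_right (le_of_lt hζ) (abs_nonneg _)).trans_lt (hrd i)
      have h2 : (1 / n : ℝ) = 1 / (2 * n) + 1 / (2 * n) := by ring
      rw [abs_lt] at h1
      constructor <;> linarith
    rw [← signedIntegral_mulConv ν μ (measurable_mellinChar E J _) (mellinChar_mul E J _)
      (integrable_mellinChar hν (fun i => (hre i).1) fun i => (hre i).2)
      (integrable_mellinChar hμ (fun i => (hre i).1) fun i => (hre i).2), h, signedIntegral,
      VectorMeasure.integral_zero_vectorMeasure]
  rcases hf.eq_zero_or_eq_zero_of_mul_eq_zero hg hz hconv with h2 | h2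
  · refine h₀ ?_
    simpa using h2 0 (by simpa using hr0)
  · refine h₁ ?_
    have h3 : (fun i => lineExponent t₀ i + Complex.I * d i) = lineExponent t₁ := by
      ext i
      rw [lineExponent, lineExponent, hd, Pi.sub_apply]
      push_cast
      ring
    have h4 := h2 Complex.I (by simpa using hr0)
    rwa [h3] at h4

end Dichotomy

/-! ### Fourier uniqueness with a signed density. -/

section Uniqueness

theorem integral_withDensity_ofReal {X : Type*} [MeasurableSpace X] (a : Measure X) {h : X → ℝ}
    (hh : Measurable h) (k : X → ℂ) :
    ∫ x, k x ∂a.withDensity (fun x => ENNReal.ofReal (h x)) = ∫ x, (max (h x) 0 : ℝ) * k x ∂a := by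
  rw [integral_withDensity_eq_integral_toReal_smul (by fun_prop) (by simp)]
  refine integral_congr_ae (Filter.Eventually.of_forall fun x => ?_)
  simp [ENNReal.toReal_ofReal', Complex.real_smul]

theorem integrable_max_zero_mul {X : Type*} [MeasurableSpace X] {a : Measure X} {h : X → ℝ}
    (hh : Measurable h) {k : X → ℂ} (hk : Measurable k) (hhk : Integrable (fun x => h x * k x) a) :
    Integrable (fun x => (max (h x) 0 : ℝ) * k x) a := by
  refine hhk.mono (by fun_prop) (Filter.Eventually.of_forall fun x => ?_)
  rw [norm_mul, norm_mul]
  refine mul_le_mul_of_nonneg_right ?_ (norm_nonneg _)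
  rw [Complex.norm_real, Complex.norm_real, Real.norm_eq_abs, Real.norm_eq_abs,
    abs_of_nonneg (le_max_right _ _)]
  exact max_le (le_abs_self _) (abs_nonneg _)

theorem integrable_withDensity_ofReal {X : Type*} [MeasurableSpace X] {a : Measure X} {h : X → ℝ}
    (hh : Measurable h) {k : X → ℂ} (hk : Measurable k) (hhk : Integrable (fun x => h x * k x) a) :
    Integrable k (a.withDensity fun x => ENNReal.ofReal (h x)) := by
  rw [integrable_withDensity_iff_integrable_smul' (by fun_prop) (by simp)]
  refine (integrable_max_zero_mul hh hk hhk).congr (Filter.Eventually.of_forall fun x => ?_)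
  simp [ENNReal.toReal_ofReal', Complex.real_smul]

/-- Fourier uniqueness for a difference of two finite measures with a common signed density. -/
theorem integral_eq_of_charFun_eq {X V : Type*} [MeasurableSpace X] [NormedAddCommGroup V]
    [InnerProductSpace ℝ V] [CompleteSpace V] [MeasurableSpace V] [BorelSpace V]
    [SecondCountableTopology V] (a b : Measure X) [IsFiniteMeasure a] [IsFiniteMeasure b]
    {h : X → ℝ} {L : X → V} (hh : Measurable h) (hL : Measurable L) (ha : Integrable h a)
    (hb : Integrable h b)
    (heq : ∀ t, ∫ x, h x * Complex.exp (inner ℝ (L x) t * Complex.I) ∂a =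
      ∫ x, h x * Complex.exp (inner ℝ (L x) t * Complex.I) ∂b)
    {G : V → ℂ} (hG : Measurable G) (hGa : Integrable (fun x => h x * G (L x)) a)
    (hGb : Integrable (fun x => h x * G (L x)) b) :
    ∫ x, h x * G (L x) ∂a = ∫ x, h x * G (L x) ∂b := by
  set p : X → ENNReal := fun x => ENNReal.ofReal (h x) with hp
  set q : X → ENNReal := fun x => ENNReal.ofReal (-h x) with hq
  have hfin : ∀ (m : Measure X), Integrable h m → IsFiniteMeasure (m.withDensity p) ∧
      IsFiniteMeasure (m.withDensity q) := fun m hm =>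
    ⟨isFiniteMeasure_withDensity_ofReal hm.2, isFiniteMeasure_withDensity_ofReal hm.neg.2⟩
  have := (hfin a ha).1
  have := (hfin a ha).2
  have := (hfin b hb).1
  have := (hfin b hb).2
  -- Negative parts are moved to the other side, so that both sides are finite positive measures
  -- determined by their characteristic functions.
  set σ₁ := (a.withDensity p + b.withDensity q).map L with hσ₁
  set σ₂ := (a.withDensity q + b.withDensity p).map L with hσ₂
  have hh' : Measurable fun x => -h x := hh.neg
  have hneg : ∀ {m : Measure X} {k : V → ℂ}, Integrable (fun x => h x * k (L x)) m →
      Integrable (fun x => ((-h x : ℝ) : ℂ) * k (L x)) m := fun hm => by simpa using hm.neg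
  -- Used twice: from right to left for exponentials, to get `σ₁ = σ₂`, and from left to right for
  -- `G`, which need not be bounded.
  have key : ∀ k : V → ℂ, Measurable k → Integrable (fun x => h x * k (L x)) a →
      Integrable (fun x => h x * k (L x)) b →
      (∫ y, k y ∂σ₁ = ∫ y, k y ∂σ₂ ↔ ∫ x, h x * k (L x) ∂a = ∫ x, h x * k (L x) ∂b) := by
    intro k hk hka hkb
    have hkL : Measurable fun x => k (L x) := hk.comp hL
    have i1 : Integrable (fun x => k (L x)) (a.withDensity p) :=
      integrable_withDensity_ofReal hh hkL hka
    have i2 : Integrable (fun x => k (L x)) (a.withDensity q) :=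
      integrable_withDensity_ofReal hh' hkL (hneg hka)
    have i3 : Integrable (fun x => k (L x)) (b.withDensity p) :=
      integrable_withDensity_ofReal hh hkL hkb
    have i4 : Integrable (fun x => k (L x)) (b.withDensity q) :=
      integrable_withDensity_ofReal hh' hkL (hneg hkb)
    have hsplit : ∀ m : Measure X, Integrable (fun x => h x * k (L x)) m →
        ∫ x, h x * k (L x) ∂m =
        ∫ x, k (L x) ∂m.withDensity p - ∫ x, k (L x) ∂m.withDensity q := by
      intro m hm
      rw [hp, hq, integral_withDensity_ofReal m hh, integral_withDensity_ofReal m hh',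
        ← integral_sub (integrable_max_zero_mul hh hkL hm)
          (integrable_max_zero_mul hh' hkL (hneg hm))]
      refine integral_congr_ae (Filter.Eventually.of_forall fun x => ?_)
      have h6 : max (h x) 0 - max (-h x) 0 = h x := max_zero_sub_max_neg_zero_eq_self (h x)
      change (h x : ℂ) * k (L x) = _ * k (L x) - _ * k (L x)
      rw [← sub_mul, ← Complex.ofReal_sub, h6]
    rw [hσ₁, hσ₂, integral_map hL.aemeasurable hk.aestronglyMeasurable,
      integral_map hL.aemeasurable hk.aestronglyMeasurable, integral_add_measure i1 i4,
      integral_add_measure i2 i3, hsplit a hka, hsplit b hkb]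
    constructor <;> intro h5
    · linear_combination h5
    · linear_combination h5
  have hσ : σ₁ = σ₂ := by
    refine Measure.ext_of_charFun (funext fun t => ?_)
    rw [charFun_apply, charFun_apply]
    have hbd : ∀ m : Measure X, Integrable h m →
        Integrable (fun x => h x * Complex.exp (inner ℝ (L x) t * Complex.I)) m := fun m hm => by
      refine hm.mono (by fun_prop) (Filter.Eventually.of_forall fun x => ?_)
      rw [norm_mul, Complex.norm_exp_ofReal_mul_I, mul_one, Complex.norm_real]
    exact (key (fun y => Complex.exp (inner ℝ y t * Complex.I)) (by fun_prop) (hbd a ha)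
      (hbd b hb)).2 (heq t)
  exact (key G hG hGa hGb).1 (by rw [hσ])

end Uniqueness

/-! ### From a vanishing Mellin transform to a vanishing reflection sum. -/

section Vanishing

/-- On the line, the character is a real weight independent of `t` times a Fourier character in the
variables `log |x_i|`. -/
theorem mellinChar_lineExponent (E J : Finset (Fin n)) (t x : Fin n → ℝ) :
    mellinChar E J (lineExponent t) x =
      (coordSign J x * ∏ i ∈ E, |x i| ^ (1 / (2 * n) : ℝ) : ℝ) *
        Complex.exp ((∑ i ∈ E, t i * Real.log |x i| : ℝ) * Complex.I) := by
  have hne : ∀ (t : Fin n → ℝ) (i : Fin n), lineExponent t i ≠ 0 := fun t i h => by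
    have h1 := lineExponent_re t i
    have h2 : (0 : ℝ) < n := by exact_mod_cast i.pos
    rw [h, Complex.zero_re] at h1
    have : (0 : ℝ) < 1 / (2 * n) := by positivity
    linarith
  have ht : lineExponent t = fun i => lineExponent (0 : Fin n → ℝ) i + Complex.I * t i := by
    ext i; simp [lineExponent]
  have h0 : mellinChar E J (lineExponent 0) x =
      (coordSign J x * ∏ i ∈ E, |x i| ^ (1 / (2 * n) : ℝ) : ℝ) := by
    rw [mellinChar]
    push_cast
    congr 1
    refine Finset.prod_congr rfl fun i _ => ?_
    rw [Complex.ofReal_cpow (abs_nonneg _)]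
    simp [lineExponent]
  have := mellinChar_add (E := E) (J := J) (ζ := Complex.I) (d := t) (hne 0)
    (fun i => by simpa [ht] using hne t i) x
  rw [← ht, h0, mul_comm Complex.I] at this
  exact this

theorem coordSign_eq_paritySign {J : Finset (Fin n)} {x : Fin n → ℝ} (hx : ∀ i ∈ J, x i ≠ 0) :
    coordSign J x = paritySign J (Finset.univ.filter fun i => x i < 0) := by
  refine Finset.prod_congr rfl fun j hj => ?_
  rcases lt_or_gt_of_ne (hx j hj) with h | h
  · simp [h, abs_of_neg h, div_neg, div_self h.ne]
  · simp [not_lt.2 h.le, abs_of_pos h, div_self h.ne']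

/-- Substitution `S ↦ S ∆ N`. With `N` the set of negative coordinates, it reduces the sum at a
point to the sum at its moduli. -/
theorem sum_paritySign_reflect (J N : Finset (Fin n)) (f : (Fin n → ℝ) → ℂ) (y : Fin n → ℝ) :
    ∑ S : Finset (Fin n), (paritySign J S : ℂ) * f (reflect S (reflect N y)) =
      paritySign J N * ∑ S : Finset (Fin n), (paritySign J S : ℂ) * f (reflect S y) := by
  rw [Finset.mul_sum]
  refine (Fintype.sum_equiv (symmDiff_left_involutive N).toPerm _ _ fun S => ?_).symm
  have h1 : paritySign J N * paritySign J S =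
      paritySign J (symmDiff S N) * 1 := by rw [paritySign_symmDiff]; ring
  have h2 : reflect S y = reflect (symmDiff S N) (reflect N y) := by
    rw [← Function.comp_apply (f := reflect (symmDiff S N)), reflect_comp_reflect,
      symmDiff_symmDiff_cancel_right]
  rw [Function.Involutive.coe_toPerm, ← mul_assoc, ← Complex.ofReal_mul, h1, mul_one, ← h2]

theorem coordPart_projMeasure_apply (E : Finset (Fin n)) (μ : SignedMeasure (Fin n → ℝ))
    {B : Set (Fin n → ℝ)} (hB : MeasurableSet B) :
    coordPart E (projMeasure E μ) B = μ (proj E ⁻¹' (B ∩ stratum E)) := by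
  rw [coordPart, VectorMeasure.restrict_apply _ (measurableSet_stratum E) hB, projMeasure,
    VectorMeasure.map_apply _ (measurable_proj E) (hB.inter (measurableSet_stratum E))]

/-- A signed measure whose Mellin transform of type `(E, J)` vanishes has a vanishing reflection
sum on the stratum `E`. -/
theorem reflectSum_eq_zero_of_mellin_eq_zero {μ : SignedMeasure (Fin n → ℝ)} (hμ : IsIntegrable μ)
    {E J : Finset (Fin n)} (hJ : J ⊆ E)
    (h : ∀ t, signedIntegral μ (mellinChar E J (lineExponent t)) = 0) :
    reflectSum J (coordPart E (projMeasure E μ)) = 0 := by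
  ext B hB
  set c : ℝ := 1 / (2 * n) with hc
  have hcpos : ∀ _ : Fin n, 0 < c := fun i => by
    have h2 : (0 : ℝ) < n := by exact_mod_cast i.pos
    positivity
  set ρ : (Fin n → ℝ) → ℝ := fun x => coordSign J x * ∏ i ∈ E, |x i| ^ c with hρ
  have hρm : Measurable ρ := by
    have := measurable_coordSign J
    fun_prop
  set L : (Fin n → ℝ) → EuclideanSpace ℝ (Fin n) :=
    fun x => WithLp.toLp 2 fun i => if i ∈ E then Real.log |x i| else 0 with hL
  have hLm : Measurable L := by
    refine (WithLp.measurable_toLp 2 _).comp (measurable_pi_lambda _ fun i => ?_)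
    by_cases hi : i ∈ E
    · simp only [hi, if_true]; fun_prop
    · simp only [hi, if_false]; fun_prop
  have hchar : ∀ (t : EuclideanSpace ℝ (Fin n)) x, mellinChar E J (lineExponent fun i => t i) x =
      ρ x * Complex.exp (inner ℝ (L x) t * Complex.I) := by
    intro t x
    rw [mellinChar_lineExponent]
    congr 4
    simp [hL, PiLp.inner_apply, Finset.sum_ite_mem]
  have hint : ∀ t, μ.Integrable (mellinChar E J (lineExponent t)) := fun t => by
    refine integrable_mellinChar hμ (fun i => ?_) fun i => ?_
    · rw [lineExponent_re]; exact hcpos i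
    · rw [lineExponent_re]
      have h2 : (0 : ℝ) < n := by exact_mod_cast i.pos
      exact one_div_le_one_div_of_le h2 (by linarith)
  have hρi : Integrable ρ μ.variation := by
    have := (hint 0).re
    refine this.congr (Filter.Eventually.of_forall fun x => ?_)
    have h0 := hchar 0 x
    rw [inner_zero_right, Complex.ofReal_zero, zero_mul, Complex.exp_zero, mul_one] at h0
    change RCLike.re (mellinChar E J (lineExponent fun i => (0 : EuclideanSpace ℝ (Fin n)) i) x) = _
    rw [h0]
    simp
  set F : (Fin n → ℝ) → ℂ := fun y => ∑ S : Finset (Fin n),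
    (paritySign J S : ℂ) * B.indicator 1 (reflect S y) with hF
  have hind : Measurable (B.indicator (1 : (Fin n → ℝ) → ℂ)) := measurable_one.indicator hB
  have hFm : Measurable F := by
    refine Finset.measurable_sum _ fun S _ => ?_
    exact (hind.comp (measurable_reflect S)).const_mul _
  -- A function of the logarithms only: `F` at the moduli, with exponentials that cancel the weight
  -- `|x_i| ^ c` in `ρ`. The sign in `ρ` then restores the signs of the coordinates.
  set G : EuclideanSpace ℝ (Fin n) → ℂ := fun y =>
    F (fun i => if i ∈ E then Real.exp (y i) else 0) * (∏ i ∈ E, Real.exp (-(c * y i)) : ℝ) with hG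
  have hGm : Measurable G := by
    refine (hFm.comp (measurable_pi_lambda _ fun i => ?_)).mul (by fun_prop)
    by_cases hi : i ∈ E
    · simp only [hi, if_true]; fun_prop
    · simp only [hi, if_false]; fun_prop
  have hset : ∀ S : Finset (Fin n), MeasurableSet (proj E ⁻¹' (reflect S ⁻¹' B ∩ stratum E)) :=
    fun S => measurable_proj E ((measurable_reflect S hB).inter (measurableSet_stratum E))
  have hpt : ∀ x, ρ x * G (L x) = ∑ S : Finset (Fin n), (paritySign J S : ℂ) *
      (proj E ⁻¹' (reflect S ⁻¹' B ∩ stratum E)).indicator 1 x := by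
    intro x
    by_cases hx : ∀ i ∈ E, x i ≠ 0
    · have hxE : proj E x ∈ stratum E := proj_mem_stratum.2 hx
      set y : Fin n → ℝ := fun i => if i ∈ E then |x i| else 0 with hy
      set N := Finset.univ.filter fun i => x i < 0 with hN
      have h1 : (fun i => if i ∈ E then Real.exp (L x i) else 0) = y := by
        ext i
        by_cases hi : i ∈ E
        · simp [hL, hy, hi, Real.exp_log_eq_abs (hx i hi)]
        · simp [hy, hi]
      have h2 : proj E x = reflect N y := by
        ext i
        by_cases hi : i ∈ E
        · by_cases hn : x i < 0
          · simp [proj, reflect, hy, hN, hi, hn, abs_of_neg hn]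
          · simp [proj, reflect, hy, hN, hi, hn, abs_of_nonneg (not_lt.1 hn)]
        · simp [proj, reflect, hy, hi]
      have h3 : (∏ i ∈ E, |x i| ^ c) * ∏ i ∈ E, Real.exp (-(c * L x i)) = 1 := by
        rw [← Finset.prod_mul_distrib]
        refine Finset.prod_eq_one fun i hi => ?_
        have : L x i = Real.log |x i| := by simp [hL, hi]
        rw [this, Real.rpow_def_of_pos (abs_pos.2 (hx i hi)), ← Real.exp_add]
        simp [mul_comm]
      have h4 : ∀ S, (proj E ⁻¹' (reflect S ⁻¹' B ∩ stratum E)).indicator (1 : (Fin n → ℝ) → ℂ) x =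
          B.indicator 1 (reflect S (reflect N y)) := by
        intro S
        rw [← h2]
        by_cases hS : reflect S (proj E x) ∈ B
        · have hmem : x ∈ proj E ⁻¹' (reflect S ⁻¹' B ∩ stratum E) := ⟨hS, hxE⟩
          rw [Set.indicator_of_mem hS, Set.indicator_of_mem hmem]
          rfl
        · rw [Set.indicator_of_notMem hS, Set.indicator_of_notMem fun h' => hS h'.1]
      simp only [h4]
      rw [sum_paritySign_reflect J N (B.indicator 1) y,
        ← coordSign_eq_paritySign fun i hi => hx i (hJ hi)]
      simp only [hG, h1]
      calc (ρ x : ℂ) * (F y * (∏ i ∈ E, Real.exp (-(c * L x i)) : ℝ))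
          = (coordSign J x * ((∏ i ∈ E, |x i| ^ c) * ∏ i ∈ E, Real.exp (-(c * L x i))) : ℝ) *
            F y := by simp only [hρ]; push_cast; ring
        _ = _ := by rw [h3, mul_one]
    · have hxE : proj E x ∉ stratum E := fun h' => hx (proj_mem_stratum.1 h')
      push Not at hx
      obtain ⟨i, hi, hxi⟩ := hx
      -- Since `c > 0`, `0 ^ c = 0`; the value chosen for `log 0` is therefore harmless.
      have h1 : ρ x = 0 := by
        simp only [hρ]
        rw [Finset.prod_eq_zero hi, mul_zero]
        rw [hxi, abs_zero, Real.zero_rpow (hcpos i).ne']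
      rw [h1, Complex.ofReal_zero, zero_mul, Finset.sum_eq_zero]
      intro S _
      rw [Set.indicator_of_notMem fun h' => hxE h'.2, mul_zero]
  have hindi : ∀ S : Finset (Fin n), μ.Integrable fun x => (paritySign J S : ℂ) *
      (proj E ⁻¹' (reflect S ⁻¹' B ∩ stratum E)).indicator 1 x := fun S =>
    ((integrable_const (1 : ℂ)).indicator (hset S)).const_mul _
  have hki : μ.Integrable fun x => ρ x * G (L x) := by
    simp only [hpt]
    exact integrable_finsetSum _ fun S _ => hindi S
  have hzero : signedIntegral μ (fun x => ρ x * G (L x)) = 0 := by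
    rw [signedIntegral_eq_sub μ hki, sub_eq_zero]
    refine integral_eq_of_charFun_eq _ _ hρm hLm (hρi.mono_measure (posPart_le_variation μ))
      (hρi.mono_measure (negPart_le_variation μ)) (fun t => ?_) hGm
      (hki.mono_measure (posPart_le_variation μ)) (hki.mono_measure (negPart_le_variation μ))
    have ht := h fun i => t i
    rw [signedIntegral_eq_sub μ (hint _), sub_eq_zero] at ht
    simpa only [hchar] using ht
  have hval : (reflectSum J (coordPart E (projMeasure E μ)) B : ℂ) =
      signedIntegral μ (fun x => ρ x * G (L x)) := by
    simp only [hpt]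
    rw [reflectSum, finsetSum_apply, signedIntegral, VectorMeasure.integral_finsetSum _
      fun S _ => hindi S, Complex.ofReal_sum]
    refine Finset.sum_congr rfl fun S _ => ?_
    simp only [← Complex.real_smul]
    rw [VectorMeasure.integral_fun_smul, smul_apply, smul_eq_mul, Complex.ofReal_mul,
      VectorMeasure.map_apply _ (measurable_reflect S) hB,
      coordPart_projMeasure_apply E μ (measurable_reflect S hB), ← signedIntegral_indicator_one _
      (hset S), Complex.real_smul]
    rfl
  rw [hzero] at hval
  exact_mod_cast hval

end Vanishing

/-! ### Sufficiency of the nonvanishing conditions. -/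

section Sufficiency

/-- Nondegenerate marginals of a symmetric measure annihilated by `ν` vanish, if `ν` satisfies the
nonvanishing condition on the corresponding stratum. -/
theorem coordPart_projMeasure_eq_zero {Fe Fo : Set (Finset (Fin n))}
    {μ ν : SignedMeasure (Fin n → ℝ)} (hν : IsIntegrable ν)
    (hμ : μ ∈ symMeasures Set.univ Fe Fo) (hconv : mulConv ν μ = 0) {E : Finset (Fin n)}
    (hE : ∀ J ∈ indexFamily E Fe Fo,
      mulConv (signDelta Finset.univ J) (coordPart E (projMeasure E ν)) ≠ 0) :
    coordPart E (projMeasure E μ) = 0 := by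
  obtain ⟨hi, -, he, ho⟩ := hμ
  refine eq_zero_of_reflectSum_eq_zero fun J => ?_
  have hsymm : ∀ F θ, μ.map (reflect F) = θ • μ → (coordPart E (projMeasure E μ)).map (reflect F) =
      θ • coordPart E (projMeasure E μ) := fun F θ h => by
    rw [coordPart_projMeasure_map_reflect, h, projMeasure_smul, coordPart_smul]
  by_cases hJE : J ⊆ E
  swap
  · obtain ⟨i, hiJ, hiE⟩ := Finset.not_subset.1 hJE
    refine reflectSum_eq_zero_of_map_eq_smul (G := {i}) (θ := 1) ?_ ?_
    · rw [one_smul, coordPart_projMeasure_map_reflect_self hiE]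
    · rw [mul_one, paritySign_singleton hiJ]
  by_cases h1 : ∀ F ∈ Fe, Even (J ∩ F).card
  swap
  · push Not at h1
    obtain ⟨F, hF, hodd⟩ := h1
    refine reflectSum_eq_zero_of_map_eq_smul (hsymm F 1 (by rw [one_smul]; exact he F hF)) ?_
    rw [mul_one, paritySign_of_odd (Nat.not_even_iff_odd.1 hodd)]
  by_cases h2 : ∀ F ∈ Fo, Odd (J ∩ F).card
  swap
  · push Not at h2
    obtain ⟨F, hF, heven⟩ := h2
    refine reflectSum_eq_zero_of_map_eq_smul
      (hsymm F (-1) ((ho F hF).trans (neg_one_smul ℝ μ).symm)) ?_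
    rw [paritySign_of_even (Nat.not_odd_iff_even.1 heven), one_mul]
  rcases mellin_eq_zero_or_eq_zero hi hν hconv E J with h3 | h3
  · exact absurd ((mulConv_signDelta_univ_eq_zero_iff J _).2
      (reflectSum_eq_zero_of_mellin_eq_zero hν hJE h3)) (hE J ⟨hJE, h1, h2⟩)
  · exact reflectSum_eq_zero_of_mellin_eq_zero hi hJE h3

end Sufficiency

/-! ### Necessity: atomic measures annihilated by `ν`. -/

section Witness

theorem mulConv_comm (μ ν : SignedMeasure (Fin n → ℝ)) : mulConv μ ν = mulConv ν μ := by
  have hm : Measurable fun p : (Fin n → ℝ) × (Fin n → ℝ) => p.1 * p.2 := by fun_prop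
  have h : VectorMeasure.prod μ ν (ContinuousLinearMap.lsmul ℝ ℝ).flip =
      (VectorMeasure.prod ν μ (ContinuousLinearMap.lsmul ℝ ℝ).flip).map Prod.swap := by
    refine VectorMeasure.prod_eq_of_forall_apply_prod fun A B hA hB => ?_
    rw [VectorMeasure.map_apply _ measurable_swap (hA.prod hB), Set.preimage_swap_prod,
      VectorMeasure.prod_apply]
    simp [mul_comm]
  rw [mulConv, mulConv, h, map_map _ measurable_swap hm]
  congr 1
  ext1 p
  exact mul_comm _ _

theorem reflectSum_map_reflect (J F : Finset (Fin n)) (τ : SignedMeasure (Fin n → ℝ)) :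
    (reflectSum J τ).map (reflect F) = paritySign J F • reflectSum J τ := by
  have h : (reflectSum J τ).map (reflect F) = reflectSum J (τ.map (reflect F)) := by
    rw [reflectSum, reflectSum, map_finsetSum]
    refine Finset.sum_congr rfl fun S _ => ?_
    rw [VectorMeasure.map_smul, map_map _ (measurable_reflect S) (measurable_reflect F),
      map_map _ (measurable_reflect F) (measurable_reflect S), reflect_comp_reflect,
      reflect_comp_reflect, symmDiff_comm]
  rw [h, reflectSum_reindex J F τ, smul_smul, ← paritySign_symmDiff, symmDiff_self,
    Finset.bot_eq_empty, paritySign_empty, one_smul]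

/-- The point with coordinates `2` on `A`, `1` on `E \ A` and `0` outside `E`, for `A ⊆ E`. -/
noncomputable def scalePoint (E A : Finset (Fin n)) (i : Fin n) : ℝ :=
  if i ∈ E then if i ∈ A then 2 else 1 else 0

/-- A discrete measure of order `E` and symmetry type `J`, all of whose marginals on proper
subsets of `E` vanish. -/
noncomputable def discreteWitness (E J : Finset (Fin n)) : SignedMeasure (Fin n → ℝ) :=
  ∑ A ∈ E.powerset, paritySign E A • reflectSum J (VectorMeasure.dirac (scalePoint E A) (1 : ℝ))

theorem discreteWitness_eq (E J : Finset (Fin n)) :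
    discreteWitness E J = ∑ p ∈ E.powerset ×ˢ (Finset.univ : Finset (Finset (Fin n))),
      (paritySign E p.1 * paritySign J p.2) •
        VectorMeasure.dirac (reflect p.2 (scalePoint E p.1)) (1 : ℝ) := by
  rw [Finset.sum_product, discreteWitness]
  refine Finset.sum_congr rfl fun A _ => ?_
  rw [reflectSum, Finset.smul_sum]
  refine Finset.sum_congr rfl fun S _ => ?_
  rw [map_dirac (measurable_reflect S), smul_smul]

theorem scalePoint_mem_stratum (E A : Finset (Fin n)) : scalePoint E A ∈ stratum E := by
  intro i
  by_cases hE : i ∈ E <;> by_cases hA : i ∈ A <;> simp [scalePoint, hE, hA]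

theorem isIntegrable_discreteWitness (E J : Finset (Fin n)) :
    IsIntegrable (discreteWitness E J) := by
  rw [discreteWitness_eq, IsIntegrable]
  refine VectorMeasure.Integrable.finsetSum_vectorMeasure fun p _ =>
    VectorMeasure.Integrable.smul_vectorMeasure ?_ _
  rw [VectorMeasure.Integrable, VectorMeasure.variation_dirac]
  refine Integrable.smul_measure ?_ (by simp)
  exact integrable_dirac (by simp)

theorem discreteWitness_map_reflect (E J F : Finset (Fin n)) :
    (discreteWitness E J).map (reflect F) = paritySign J F • discreteWitness E J := by
  rw [discreteWitness, map_finsetSum, Finset.smul_sum]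
  refine Finset.sum_congr rfl fun A _ => ?_
  rw [VectorMeasure.map_smul, reflectSum_map_reflect, smul_comm]

theorem concentratedOn_discreteWitness (E J : Finset (Fin n)) :
    ConcentratedOn (discreteWitness E J) (stratum E) := by
  intro B _ hB
  rw [discreteWitness_eq, finsetSum_apply]
  refine Finset.sum_eq_zero fun p _ => ?_
  rw [smul_apply, VectorMeasure.dirac_apply_of_notMem, smul_zero]
  exact fun h => hB h (reflect_mem_stratum.2 (scalePoint_mem_stratum E p.1))

theorem discreteWitness_mem_symMeasures {E J : Finset (Fin n)} {Fe Fo : Set (Finset (Fin n))}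
    (hJ : J ∈ indexFamily E Fe Fo) : discreteWitness E J ∈ symMeasures (stratum E) Fe Fo := by
  refine ⟨isIntegrable_discreteWitness E J, concentratedOn_discreteWitness E J, fun F hF => ?_,
    fun F hF => ?_⟩
  · rw [EvenUnder, discreteWitness_map_reflect, paritySign_of_even (hJ.2.1 F hF), one_smul]
  · rw [OddUnder, discreteWitness_map_reflect, paritySign_of_odd (hJ.2.2 F hF)]
    exact neg_one_smul ℝ (discreteWitness E J)

/-- No cancellation occurs at `scalePoint E ∅`: the moduli `1` and `2` force `A = ∅`, positivity
forces `S` to avoid `E` and hence `J`, so each contribution there has sign `+1`. -/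
theorem discreteWitness_ne_zero {E J : Finset (Fin n)} (hJ : J ⊆ E) : discreteWitness E J ≠ 0 := by
  intro h
  have h0 : discreteWitness E J {scalePoint E ∅} = 0 := by rw [h]; rfl
  rw [discreteWitness_eq, finsetSum_apply] at h0
  refine absurd h0 (ne_of_gt (Finset.sum_pos' (fun p hp => ?_)
    ⟨(∅, ∅), by simp, by simp [reflect_empty]⟩))
  obtain ⟨A, S⟩ := p
  simp only [Finset.mem_product, Finset.mem_powerset, Finset.mem_univ, and_true] at hp
  rw [smul_apply]
  by_cases hmem : reflect S (scalePoint E A) ∈ ({scalePoint E ∅} : Set (Fin n → ℝ))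
  swap
  · rw [VectorMeasure.dirac_apply_of_notMem hmem, smul_zero]
  rw [VectorMeasure.dirac_apply_of_mem (measurableSet_singleton _) hmem, smul_eq_mul, mul_one]
  have hi : ∀ i ∈ E, i ∉ A ∧ i ∉ S := by
    intro i hiE
    have h1 := congrFun hmem i
    by_cases hA : i ∈ A <;> by_cases hS : i ∈ S <;>
      simp [reflect, scalePoint, hiE, hA, hS] at h1 ⊢ <;> norm_num at h1
  have hA : E ∩ A = ∅ := by
    ext i; simpa using fun h => (hi i h).1
  have hS : J ∩ S = ∅ := by
    ext i; simpa using fun h => (hi i (hJ h)).2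
  rw [paritySign_eq_pow, paritySign_eq_pow, hA, hS]
  simp

/-- Toggling `i` in `A` flips the sign of a term, while multiplication by `x` with `x_i = 0` hides
the change of scale. -/
theorem discreteWitness_map_mul_eq_zero {E J : Finset (Fin n)} {x : Fin n → ℝ} {i : Fin n}
    (hi : i ∈ E) (hx : x i = 0) : (discreteWitness E J).map (fun y => x * y) = 0 := by
  have hm : Measurable fun y : Fin n → ℝ => x * y := by fun_prop
  rw [discreteWitness_eq, map_finsetSum]
  refine Finset.sum_involution (fun p _ => (symmDiff p.1 {i}, p.2)) ?_ ?_ ?_ ?_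
  · intro p _
    have h1 : x * reflect p.2 (scalePoint E (symmDiff p.1 {i})) =
        x * reflect p.2 (scalePoint E p.1) := by
      ext j
      by_cases hj : j = i
      · subst hj; simp [hx]
      · simp [reflect, scalePoint, Finset.mem_symmDiff, hj]
    rw [VectorMeasure.map_smul, VectorMeasure.map_smul, map_dirac hm, map_dirac hm, h1,
      paritySign_symmDiff, paritySign_singleton hi, ← add_smul]
    have : paritySign E p.1 * paritySign J p.2 + paritySign E p.1 * -1 * paritySign J p.2 = 0 := by
      ring
    rw [this, zero_smul]
  · intro p _ _ heq
    have h1 := congrArg Prod.fst heq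
    simp at h1
  · intro p hp
    simp only [Finset.mem_product, Finset.mem_powerset, Finset.mem_univ, and_true] at hp ⊢
    intro j hj
    rw [Finset.mem_symmDiff, Finset.mem_singleton] at hj
    rcases hj with ⟨hj, -⟩ | ⟨rfl, -⟩
    · exact hp hj
    · exact hi
  · intro p _
    simp

/-- The inner integral `H x` depends only on `proj E x`, as the atoms vanish outside `E`, and it is
zero when a coordinate in `E` is. -/
theorem mulConv_discreteWitness (E J : Finset (Fin n)) (ν : SignedMeasure (Fin n → ℝ)) :
    mulConv ν (discreteWitness E J) =
      mulConv (coordPart E (projMeasure E ν)) (discreteWitness E J) := by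
  ext B hB
  rw [mulConv_apply' _ _ hB, mulConv_apply' _ _ hB]
  set H : (Fin n → ℝ) → ℝ := fun x => (discreteWitness E J).map (fun y => x * y) B with hH
  have hHeq : H = fun x => ∑ p ∈ E.powerset ×ˢ (Finset.univ : Finset (Finset (Fin n))),
      (paritySign E p.1 * paritySign J p.2) *
        B.indicator 1 (x * reflect p.2 (scalePoint E p.1)) := by
    ext x
    have hm : Measurable fun y : Fin n → ℝ => x * y := by fun_prop
    simp only [hH]
    rw [discreteWitness_eq, map_finsetSum, finsetSum_apply]
    refine Finset.sum_congr rfl fun p _ => ?_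
    rw [VectorMeasure.map_smul, map_dirac hm, smul_apply, smul_eq_mul]
    by_cases h : x * reflect p.2 (scalePoint E p.1) ∈ B
    · rw [VectorMeasure.dirac_apply_of_mem hB h, Set.indicator_of_mem h]; rfl
    · rw [VectorMeasure.dirac_apply_of_notMem h, Set.indicator_of_notMem h]
  have hterm : ∀ z : Fin n → ℝ, Measurable fun x : Fin n → ℝ =>
      B.indicator (1 : (Fin n → ℝ) → ℝ) (x * z) := fun z =>
    (measurable_one.indicator hB).comp (by fun_prop)
  have hHm : Measurable H := by
    rw [hHeq]
    exact Finset.measurable_sum _ fun p _ => (hterm _).const_mul _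
  have hHi : ∀ m : Measure (Fin n → ℝ), IsFiniteMeasure m → Integrable H m := by
    intro m hm
    rw [hHeq]
    refine integrable_finsetSum _ fun p _ => Integrable.const_mul ?_ _
    refine (integrable_const (1 : ℝ)).mono' (hterm _).aestronglyMeasurable
      (Filter.Eventually.of_forall fun x => ?_)
    by_cases h : x * reflect p.2 (scalePoint E p.1) ∈ B <;> simp [h]
  have hproj : ∀ x, H (proj E x) = H x := by
    intro x
    have : ∀ p : Finset (Fin n) × Finset (Fin n),
        proj E x * reflect p.2 (scalePoint E p.1) = x * reflect p.2 (scalePoint E p.1) := by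
      intro p
      ext i
      by_cases hi : i ∈ E <;> simp [proj, reflect, scalePoint, hi]
    simp only [hHeq, this]
  have hind : ∀ x, (stratum E).indicator H (proj E x) = H x := by
    intro x
    by_cases h : proj E x ∈ stratum E
    · rw [Set.indicator_of_mem h, hproj]
    · rw [Set.indicator_of_notMem h]
      rw [proj_mem_stratum] at h
      push Not at h
      obtain ⟨i, hi, hx⟩ := h
      have h0 := discreteWitness_map_mul_eq_zero (J := J) hi hx
      change 0 = (discreteWitness E J).map (fun y => x * y) B
      rw [h0]
      rfl
  rw [coordPart, ← VectorMeasure.integral_indicator (measurableSet_stratum E), projMeasure,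
    VectorMeasure.integral_map (measurable_proj E)]
  · exact congrArg (fun f => VectorMeasure.integral ν f _) (funext hind).symm
  · exact (hHm.indicator (measurableSet_stratum E)).aestronglyMeasurable
  · have : (stratum E).indicator H ∘ proj E = H := funext hind
    rw [this]
    exact hHi _ inferInstance

/-- Scaling commutes with reflections, so each `A` contributes a scaled image of the same vanishing
reflection sum. -/
theorem mulConv_discreteWitness_eq_zero {E J : Finset (Fin n)} {ν : SignedMeasure (Fin n → ℝ)}
    (h : mulConv (signDelta Finset.univ J) (coordPart E (projMeasure E ν)) = 0) :
    mulConv ν (discreteWitness E J) = 0 := by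
  rw [mulConv_signDelta_univ_eq_zero_iff] at h
  set τ := coordPart E (projMeasure E ν)
  rw [mulConv_discreteWitness, mulConv_comm, discreteWitness_eq, mulConv_sum_dirac_left,
    Finset.sum_product]
  refine Finset.sum_eq_zero fun A _ => ?_
  have hm : Measurable fun y : Fin n → ℝ => scalePoint E A * y := by fun_prop
  have h1 : ∑ S : Finset (Fin n), (paritySign E A * paritySign J S) •
      τ.map (fun y => reflect S (scalePoint E A) * y) =
      paritySign E A • (reflectSum J τ).map fun y => scalePoint E A * y := by
    rw [reflectSum, map_finsetSum, Finset.smul_sum]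
    refine Finset.sum_congr rfl fun S _ => ?_
    rw [VectorMeasure.map_smul, smul_smul, map_map _ (measurable_reflect S) hm]
    congr 2
    ext1 y
    rw [Function.comp_apply, mul_reflect, reflect_mul]
  rw [h1, h, VectorMeasure.map_zero, smul_zero]

theorem not_universalOn_of_mulConv_eq_zero {E J : Finset (Fin n)} {Fe Fo : Set (Finset (Fin n))}
    (hJ : J ∈ indexFamily E Fe Fo) {ν : SignedMeasure (Fin n → ℝ)}
    (h : mulConv (signDelta Finset.univ J) (coordPart E (projMeasure E ν)) = 0) :
    ¬ UniversalOn ν (symMeasures (stratum E) Fe Fo) := fun hu =>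
  discreteWitness_ne_zero hJ.1
    (hu _ (discreteWitness_mem_symMeasures hJ) (mulConv_discreteWitness_eq_zero h))

end Witness

/-! ### Parity systems as linear algebra over `𝔽₂`. -/

section ParitySystems

/-- The indicator vector of a finite set over `𝔽₂`. -/
def indicatorVec (F : Finset (Fin n)) (i : Fin n) : ZMod 2 := if i ∈ F then 1 else 0

theorem indicatorVec_injective : Function.Injective (indicatorVec (n := n)) := by
  intro F G h
  ext i
  have := congrFun h i
  by_cases hF : i ∈ F <;> by_cases hG : i ∈ G <;> simp_all [indicatorVec]

theorem indicatorVec_symmDiff (F G : Finset (Fin n)) :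
    indicatorVec (symmDiff F G) = indicatorVec F + indicatorVec G := by
  ext1 i
  by_cases hF : i ∈ F <;> by_cases hG : i ∈ G <;>
    simp [indicatorVec, Finset.mem_symmDiff, hF, hG]
  decide

theorem indicatorVec_empty : indicatorVec (∅ : Finset (Fin n)) = 0 := by
  ext1 i; simp [indicatorVec]

theorem indicatorVec_symmDiffList_append (L M : List (Finset (Fin n))) :
    indicatorVec (symmDiffList (L ++ M)) =
      indicatorVec (symmDiffList L) + indicatorVec (symmDiffList M) := by
  induction L with
  | nil => simp [symmDiffList, indicatorVec_empty]
  | cons F L ih =>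
    change indicatorVec (symmDiff F (symmDiffList (L ++ M))) =
      indicatorVec (symmDiff F (symmDiffList L)) + _
    rw [indicatorVec_symmDiff, indicatorVec_symmDiff, ih, add_assoc]

/-- The parity constraints imposed by a pair of families, as vectors over `𝔽₂`. -/
def parityConstraints (Fe Fo : Set (Finset (Fin n))) : Set ((Fin n → ZMod 2) × ZMod 2) :=
  (fun F => (indicatorVec F, 0)) '' Fe ∪ (fun F => (indicatorVec F, 1)) '' Fo

/-- Over `𝔽₂` a linear combination is a plain sum; the last coordinate counts the members of `Fo`
modulo 2. -/
theorem exists_lists_of_mem_span {Fe Fo : Set (Finset (Fin n))}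
    {v : (Fin n → ZMod 2) × ZMod 2}
    (hv : v ∈ Submodule.span (ZMod 2) (parityConstraints Fe Fo)) :
    ∃ L M : List (Finset (Fin n)), (∀ F ∈ L, F ∈ Fe) ∧ (∀ F ∈ M, F ∈ Fo) ∧
      (M.length : ZMod 2) = v.2 ∧ indicatorVec (symmDiffList (L ++ M)) = v.1 := by
  induction hv using Submodule.span_induction with
  | mem v hv =>
    rcases hv with ⟨F, hF, rfl⟩ | ⟨F, hF, rfl⟩
    · exact ⟨[F], [], by simpa using hF, by simp, by simp,
        by simp [symmDiffList, indicatorVec_symmDiff, indicatorVec_empty]⟩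
    · exact ⟨[], [F], by simp, by simpa using hF, by simp,
        by simp [symmDiffList, indicatorVec_symmDiff, indicatorVec_empty]⟩
  | zero => exact ⟨[], [], by simp, by simp, by simp, by simp [symmDiffList, indicatorVec_empty]⟩
  | add v w _ _ hv hw =>
    obtain ⟨L, M, hL, hM, h1, h2⟩ := hv
    obtain ⟨L', M', hL', hM', h1', h2'⟩ := hw
    refine ⟨L ++ L', M ++ M', ?_, ?_, ?_, ?_⟩
    · intro F hF
      exact (List.mem_append.1 hF).elim (hL F) (hL' F)
    · intro F hF
      exact (List.mem_append.1 hF).elim (hM F) (hM' F)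
    · rw [List.length_append, Nat.cast_add, h1, h1', Prod.snd_add]
    · rw [Prod.fst_add, ← h2, ← h2']
      simp only [indicatorVec_symmDiffList_append]
      abel
  | smul a v _ hv =>
    have ha : a = 0 ∨ a = 1 := (by decide : ∀ a : ZMod 2, a = 0 ∨ a = 1) a
    rcases ha with rfl | rfl
    · exact ⟨[], [], by simp, by simp, by simp, by simp [symmDiffList, indicatorVec_empty]⟩
    · simpa using hv

theorem mem_evenPart_of_mem_span {Fe Fo : Set (Finset (Fin n))} {G : Finset (Fin n)}
    (h : (indicatorVec G, 0) ∈ Submodule.span (ZMod 2) (parityConstraints Fe Fo)) :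
    G ∈ evenPart Fe Fo := by
  obtain ⟨L, M, hL, hM, h1, h2⟩ := exists_lists_of_mem_span h
  exact ⟨L, M, hL, hM, (ZMod.natCast_eq_zero_iff_even).1 h1, (indicatorVec_injective h2).symm⟩

theorem mem_oddPart_of_mem_span {Fe Fo : Set (Finset (Fin n))} {G : Finset (Fin n)}
    (h : (indicatorVec G, 1) ∈ Submodule.span (ZMod 2) (parityConstraints Fe Fo)) :
    G ∈ oddPart Fe Fo := by
  obtain ⟨L, M, hL, hM, h1, h2⟩ := exists_lists_of_mem_span h
  exact ⟨L, M, hL, hM, (ZMod.natCast_eq_one_iff_odd).1 h1, (indicatorVec_injective h2).symm⟩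

/-- A consistent system of parity constraints has a solution. -/
theorem exists_finset_of_notMem_span {T : Set ((Fin n → ZMod 2) × ZMod 2)}
    (hT : ((0, 1) : (Fin n → ZMod 2) × ZMod 2) ∉ Submodule.span (ZMod 2) T) :
    ∃ J : Finset (Fin n), ∀ F c, (indicatorVec F, c) ∈ T → ((J ∩ F).card : ZMod 2) = c := by
  obtain ⟨φ, hφ, hker⟩ := Submodule.exists_le_ker_of_notMem hT
  have h01 : ∀ a : ZMod 2, a ≠ 0 → a = 1 := by decide
  have hφ1 : φ (0, 1) = 1 := h01 _ hφ
  -- `φ` kills the constraints and has `φ (0, 1) = 1`, so its coefficients on the basis vectors are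
  -- the indicator of a solution.
  refine ⟨Finset.univ.filter fun i => φ (Pi.single i 1, 0) = 1, fun F c hF => ?_⟩
  have h0 : φ (indicatorVec F, c) = 0 := hker (Submodule.subset_span hF)
  have hdec : ((indicatorVec F, c) : (Fin n → ZMod 2) × ZMod 2) =
      (∑ i, indicatorVec F i • (Pi.single i 1, 0)) + c • (0, 1) := by
    refine Prod.ext ?_ ?_
    · ext1 j
      simp [Prod.fst_sum, Finset.sum_apply, Pi.single_apply]
    · simp [Prod.snd_sum]
  have hcard : φ (∑ i, indicatorVec F i • ((Pi.single i 1, 0) : (Fin n → ZMod 2) × ZMod 2)) =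
      (((Finset.univ.filter fun i => φ (Pi.single i 1, 0) = 1) ∩ F).card : ZMod 2) := by
    rw [map_sum, Finset.cast_card, ← Finset.filter_mem_eq_inter, Finset.filter_filter,
      Finset.sum_filter]
    refine Finset.sum_congr rfl fun i _ => ?_
    rw [map_smul, indicatorVec]
    by_cases hi : i ∈ F
    · by_cases h1 : φ (Pi.single i 1, 0) = 1
      · simp [hi, h1]
      · have h2 : φ (Pi.single i 1, 0) = 0 := not_not.1 fun h => h1 (h01 _ h)
        simp [hi, h2]
    · simp [hi]
  rw [hdec, map_add, hcard, map_smul, hφ1, smul_eq_mul, mul_one] at h0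
  generalize ((Finset.univ.filter fun i => φ (Pi.single i 1, 0) = 1) ∩ F).card = k at h0 ⊢
  have h2 : ∀ a c : ZMod 2, a + c = 0 → a = c := by decide
  exact h2 _ _ h0

/-- Properness makes the restricted system consistent. Adding the equation `|J ∩ G| = c` could only
break this if the opposite equation, with `c + 1`, were already a consequence. -/
theorem exists_mem_indexFamily {Fe Fo : Set (Finset (Fin n))} {E G : Finset (Fin n)} (hG : G ⊆ E)
    (hproper : IsProper (restrictFamily Fe E) (restrictFamily Fo E)) {c : ZMod 2}
    (h : (indicatorVec G, c + 1) ∉ Submodule.span (ZMod 2)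
      (parityConstraints (restrictFamily Fe E) (restrictFamily Fo E))) :
    ∃ J ∈ indexFamily E Fe Fo, ((J ∩ G).card : ZMod 2) = c := by
  set T := parityConstraints (restrictFamily Fe E) (restrictFamily Fo E) with hTdef
  have hT : ((0, 1) : (Fin n → ZMod 2) × ZMod 2) ∉ Submodule.span (ZMod 2) T := by
    intro h1
    rw [← indicatorVec_empty] at h1
    have h2 : (∅ : Finset (Fin n)) ∈ evenPart (restrictFamily Fe E) (restrictFamily Fo E) :=
      ⟨[], [], by simp, by simp, by simp, rfl⟩
    have h3 := Set.mem_inter h2 (mem_oddPart_of_mem_span h1)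
    rw [hproper] at h3
    exact h3
  have hT' : ((0, 1) : (Fin n → ZMod 2) × ZMod 2) ∉
      Submodule.span (ZMod 2) (insert (indicatorVec G, c) T) := by
    intro h1
    obtain ⟨a, z, hz, hza⟩ := Submodule.mem_span_insert.1 h1
    have ha : a = 0 ∨ a = 1 := (by decide : ∀ a : ZMod 2, a = 0 ∨ a = 1) a
    rcases ha with rfl | rfl
    · rw [zero_smul, zero_add] at hza
      exact hT (hza ▸ hz)
    · refine h ?_
      rw [one_smul] at hza
      suffices heq : (indicatorVec G, c + 1) = z from heq ▸ hz
      have hfst : z.1 = -indicatorVec G := by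
        rw [← add_eq_zero_iff_neg_eq.1 (congrArg Prod.fst hza).symm]
      have hsnd : z.2 = c + 1 :=
        (by decide : ∀ c d : ZMod 2, 1 = c + d → d = c + 1) c z.2 (congrArg Prod.snd hza)
      have hneg : ∀ a : ZMod 2, -a = a := by decide
      refine Prod.ext ?_ hsnd.symm
      rw [hfst]
      ext1 i
      exact (hneg _).symm
  obtain ⟨J, hJ⟩ := exists_finset_of_notMem_span hT'
  have hJE : ∀ F, J ∩ E ∩ F = J ∩ (F ∩ E) := fun F => by
    rw [Finset.inter_assoc, Finset.inter_comm E]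
  refine ⟨J ∩ E, ⟨Finset.inter_subset_right, fun F hF => ?_, fun F hF => ?_⟩, ?_⟩
  · rw [hJE, ← ZMod.natCast_eq_zero_iff_even]
    exact hJ _ _ (Set.mem_insert_of_mem _ (Or.inl ⟨F ∩ E, ⟨F, hF, rfl⟩, rfl⟩))
  · rw [hJE, ← ZMod.natCast_eq_one_iff_odd]
    exact hJ _ _ (Set.mem_insert_of_mem _ (Or.inr ⟨F ∩ E, ⟨F, hF, rfl⟩, rfl⟩))
  · rw [hJE, Finset.inter_eq_left.2 hG]
    exact hJ _ _ (Set.mem_insert _ _)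

theorem exists_list_lift {Fam : Set (Finset (Fin n))} {E : Finset (Fin n)}
    (L : List (Finset (Fin n))) (hL : ∀ F ∈ L, F ∈ restrictFamily Fam E) :
    ∃ L' : List (Finset (Fin n)), (∀ F ∈ L', F ∈ Fam) ∧ L'.map (fun F => F ∩ E) = L := by
  induction L with
  | nil => exact ⟨[], by simp, rfl⟩
  | cons F L ih =>
    obtain ⟨L', h1, h2⟩ := ih fun F' hF' => hL F' (List.mem_cons_of_mem _ hF')
    obtain ⟨F', hF', rfl⟩ := hL F List.mem_cons_self
    refine ⟨F' :: L', ?_, by rw [List.map_cons, h2]⟩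
    intro F'' hF''
    rcases List.mem_cons.1 hF'' with rfl | h
    · exact hF'
    · exact h1 _ h

theorem symmDiffList_map_inter (E : Finset (Fin n)) (L : List (Finset (Fin n))) :
    symmDiffList (L.map fun F => F ∩ E) = symmDiffList L ∩ E := by
  induction L with
  | nil => simp [symmDiffList]
  | cons F L ih =>
    change symmDiff (F ∩ E) (symmDiffList (L.map fun F => F ∩ E)) = symmDiff F (symmDiffList L) ∩ E
    rw [ih]
    exact (inf_symmDiff_distrib_right _ _ _).symm

theorem evenPart_restrictFamily_subset (Fe Fo : Set (Finset (Fin n))) (E : Finset (Fin n)) :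
    evenPart (restrictFamily Fe E) (restrictFamily Fo E) ⊆ restrictFamily (evenPart Fe Fo) E := by
  rintro G ⟨L, M, hL, hM, hlen, rfl⟩
  obtain ⟨L', hL', rfl⟩ := exists_list_lift L hL
  obtain ⟨M', hM', rfl⟩ := exists_list_lift M hM
  refine ⟨_, ⟨L', M', hL', hM', by simpa using hlen, rfl⟩, ?_⟩
  rw [← List.map_append, symmDiffList_map_inter]

theorem oddPart_restrictFamily_subset (Fe Fo : Set (Finset (Fin n))) (E : Finset (Fin n)) :
    oddPart (restrictFamily Fe E) (restrictFamily Fo E) ⊆ restrictFamily (oddPart Fe Fo) E := by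
  rintro G ⟨L, M, hL, hM, hlen, rfl⟩
  obtain ⟨L', hL', rfl⟩ := exists_list_lift L hL
  obtain ⟨M', hM', rfl⟩ := exists_list_lift M hM
  refine ⟨_, ⟨L', M', hL', hM', by simpa using hlen, rfl⟩, ?_⟩
  rw [← List.map_append, symmDiffList_map_inter]

end ParitySystems

/-! ### Measures of order `[n]`. -/

section FullOrder

theorem coordPart_univ_of_hasOrder {ν : SignedMeasure (Fin n → ℝ)}
    (h : HasOrder ν Finset.univ) : coordPart Finset.univ ν = ν := by
  conv_rhs => rw [← sum_coordPart ν]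
  refine (Finset.sum_eq_single_of_mem (f := fun F => coordPart F ν) Finset.univ
    (Finset.mem_univ _) fun F _ hF => ?_).symm
  rw [coordPart, ← VectorMeasure.variation_eq_zero,
    VectorMeasure.variation_restrict (measurableSet_stratum F), Measure.restrict_eq_zero]
  exact h.2 F hF

/-- `ν` lives where no coordinate vanishes, so its projection has no vanishing coordinate in `E`. -/
theorem coordPart_projMeasure_of_hasOrder {ν : SignedMeasure (Fin n → ℝ)}
    (h : HasOrder ν Finset.univ) (E : Finset (Fin n)) :
    coordPart E (projMeasure E ν) = projMeasure E ν := by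
  ext B hB
  have hE := measurable_proj E (hB.inter (measurableSet_stratum E))
  have hB' := measurable_proj E hB
  rw [coordPart_projMeasure_apply E ν hB, projMeasure,
    VectorMeasure.map_apply _ (measurable_proj E) hB, ← coordPart_univ_of_hasOrder h, coordPart,
    VectorMeasure.restrict_apply _ (measurableSet_stratum _) hE,
    VectorMeasure.restrict_apply _ (measurableSet_stratum _) hB']
  congr 1
  ext x
  constructor
  · exact fun hx => ⟨hx.1.1, hx.2⟩
  · exact fun hx => ⟨⟨hx.1, proj_mem_stratum.2 fun i _ => (hx.2 i).2 (Finset.mem_univ i)⟩, hx.2⟩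

theorem sum_comp_inter {M : Type*} [AddCommMonoid M] (J : Finset (Fin n))
    (g : Finset (Fin n) → M) :
    ∑ S : Finset (Fin n), g (J ∩ S) = 2 ^ Jᶜ.card • ∑ S ∈ J.powerset, g S := by
  have h : ∑ S : Finset (Fin n), g (J ∩ S) = ∑ p ∈ J.powerset ×ˢ Jᶜ.powerset, g p.1 := by
    refine Finset.sum_nbij' (fun S => (J ∩ S, Jᶜ ∩ S)) (fun p => p.1 ∪ p.2) ?_ ?_ ?_ ?_ ?_
    · intro S _
      simp [Finset.inter_subset_left]
    · simp
    · intro S _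
      rw [← Finset.union_inter_distrib_right, Finset.union_compl, Finset.univ_inter]
    · rintro ⟨A, B⟩ hp
      rw [Finset.mem_product, Finset.mem_powerset, Finset.mem_powerset] at hp
      refine Prod.ext ?_ ?_
      · ext i
        have h1 := @hp.1 i
        have h2 := @hp.2 i
        simp only [Finset.mem_compl] at h2
        simp only [Finset.mem_inter, Finset.mem_union]
        tauto
      · ext i
        have h1 := @hp.1 i
        have h2 := @hp.2 i
        simp only [Finset.mem_compl] at h2
        simp only [Finset.mem_inter, Finset.mem_union, Finset.mem_compl]
        tauto
    · intro S _
      rfl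
  rw [h, Finset.sum_product]
  simp [Finset.smul_sum]

/-- After projection to `J` a reflection matters only through `J ∩ S`, so each subset of `J` is
counted `2 ^ |Jᶜ|` times. -/
theorem mulConv_signDelta_self_eq_zero_iff (J : Finset (Fin n))
    (ν : SignedMeasure (Fin n → ℝ)) :
    mulConv (signDelta J J) ν = 0 ↔ reflectSum J (projMeasure J ν) = 0 := by
  have h : reflectSum J (projMeasure J ν) = ∑ S : Finset (Fin n),
      paritySign J (J ∩ S) • ν.map (proj J ∘ reflect (J ∩ S)) := by
    rw [reflectSum]
    refine Finset.sum_congr rfl fun S _ => ?_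
    have h1 : proj J ∘ reflect (J ∩ S) = reflect S ∘ proj J := by
      ext x i
      by_cases hJ : i ∈ J <;> by_cases hS : i ∈ S <;> simp [proj, reflect, hJ, hS]
    rw [h1, projMeasure, map_map _ (measurable_proj J) (measurable_reflect S), paritySign_eq_pow,
      paritySign_eq_pow, ← Finset.inter_assoc, Finset.inter_self]
  rw [mulConv_signDelta_eq_zero_iff subset_rfl, h,
    sum_comp_inter J fun S => paritySign J S • ν.map (proj J ∘ reflect S),
    ← Nat.cast_smul_eq_nsmul ℝ, smul_eq_zero_iff_right]
  positivity

theorem reflectSum_projMeasure_of_subset {E J : Finset (Fin n)} (hJ : J ⊆ E)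
    (ν : SignedMeasure (Fin n → ℝ)) :
    (reflectSum J (projMeasure E ν)).map (proj J) = reflectSum J (projMeasure J ν) := by
  rw [reflectSum, reflectSum, map_finsetSum]
  refine Finset.sum_congr rfl fun S _ => ?_
  rw [VectorMeasure.map_smul, map_map _ (measurable_reflect S) (measurable_proj J), projMeasure,
    projMeasure, map_map _ (measurable_proj E) ((measurable_proj J).comp (measurable_reflect S)),
    map_map _ (measurable_proj J) (measurable_reflect S), proj_comp_reflect, Function.comp_assoc,
    proj_comp_proj hJ]

end FullOrder

/-! ### Assembly of the universality criteria. -/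

section Universality

theorem concentratedOn_univ (μ : SignedMeasure (Fin n → ℝ)) : ConcentratedOn μ Set.univ := by
  intro B _ hB
  rw [Set.compl_univ, Set.subset_empty_iff] at hB
  rw [hB, μ.empty]

theorem symMeasures_subset_univ (A : Set (Fin n → ℝ)) (Fe Fo : Set (Finset (Fin n))) :
    symMeasures A Fe Fo ⊆ symMeasures Set.univ Fe Fo := fun μ hμ =>
  ⟨hμ.1, concentratedOn_univ μ, hμ.2.2⟩

theorem coordPart_of_concentratedOn {E : Finset (Fin n)} {μ : SignedMeasure (Fin n → ℝ)}
    (h : ConcentratedOn μ (stratum E)) : coordPart E μ = μ := by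
  conv_rhs => rw [← VectorMeasure.restrict_add_restrict_compl (v := μ) (measurableSet_stratum E)]
  rw [coordPart, left_eq_add]
  ext B hB
  have hc := (measurableSet_stratum E).compl
  rw [VectorMeasure.restrict_apply _ hc hB]
  exact h _ (hB.inter hc) Set.inter_subset_right

theorem projMeasure_univ (μ : SignedMeasure (Fin n → ℝ)) : projMeasure Finset.univ μ = μ := by
  rw [projMeasure, proj_univ, VectorMeasure.map_id]

theorem universalOn_stratum_univ_iff (Fe Fo : Set (Finset (Fin n)))
    {ν : SignedMeasure (Fin n → ℝ)} (hν : IsIntegrable ν) :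
    UniversalOn ν (symMeasures (stratum Finset.univ) Fe Fo) ↔
      ∀ J ∈ indexFamily Finset.univ Fe Fo,
        mulConv (signDelta Finset.univ J) (coordPart Finset.univ ν) ≠ 0 := by
  constructor
  · intro h J hJ h0
    rw [← projMeasure_univ ν] at h0
    exact not_universalOn_of_mulConv_eq_zero hJ h0 h
  · intro h μ hμ hconv
    have := coordPart_projMeasure_eq_zero hν (symMeasures_subset_univ _ Fe Fo hμ) hconv
      (E := Finset.univ) (by simpa only [projMeasure_univ] using h)
    rwa [projMeasure_univ, coordPart_of_concentratedOn hμ.2.1] at this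

theorem universalOn_univ_iff (Fe Fo : Set (Finset (Fin n)))
    {ν : SignedMeasure (Fin n → ℝ)} (hν : IsIntegrable ν) :
    UniversalOn ν (symMeasures Set.univ Fe Fo) ↔
      ∀ E : Finset (Fin n), ∀ J ∈ indexFamily E Fe Fo,
        mulConv (signDelta Finset.univ J) (coordPart E (projMeasure E ν)) ≠ 0 := by
  constructor
  · intro h E J hJ h0
    exact not_universalOn_of_mulConv_eq_zero hJ h0 fun μ hμ =>
      h μ (symMeasures_subset_univ _ Fe Fo hμ)
  · intro h μ hμ hconv
    exact eq_zero_of_coordPart_projMeasure_eq_zero fun E =>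
      coordPart_projMeasure_eq_zero hν hμ hconv (h E)

theorem universalOn_univ_iff_of_hasOrder (Fe Fo : Set (Finset (Fin n)))
    {ν : SignedMeasure (Fin n → ℝ)} (hν : IsIntegrable ν) (ho : HasOrder ν Finset.univ) :
    UniversalOn ν (symMeasures Set.univ Fe Fo) ↔
      ∀ J ∈ indexFamily Finset.univ Fe Fo, mulConv (signDelta J J) ν ≠ 0 := by
  simp only [universalOn_univ_iff Fe Fo hν, coordPart_projMeasure_of_hasOrder ho, ne_eq,
    mulConv_signDelta_univ_eq_zero_iff, mulConv_signDelta_self_eq_zero_iff]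
  constructor
  · exact fun h J hJ => h J J ⟨subset_rfl, hJ.2⟩
  · intro h E J hJ h0
    -- A failure at `(E, J)` is carried by projection to a failure at `(J, J)`.
    refine h J ⟨Finset.subset_univ J, hJ.2⟩ ?_
    rw [← reflectSum_projMeasure_of_subset hJ.1, h0, VectorMeasure.map_zero]

theorem mulConv_signDelta_coordPart_eq_zero {E J G : Finset (Fin n)} {θ : ℝ}
    {ν : SignedMeasure (Fin n → ℝ)}
    (h : (projMeasure E ν).map (reflect G) = θ • projMeasure E ν)
    (hθ : paritySign J G * θ = -1) :
    mulConv (signDelta Finset.univ J) (coordPart E (projMeasure E ν)) = 0 := by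
  rw [mulConv_signDelta_univ_eq_zero_iff]
  refine reflectSum_eq_zero_of_map_eq_smul (G := G) (θ := θ) ?_ hθ
  rw [coordPart_projMeasure_map_reflect, ← projMeasure_map_reflect, h, coordPart_smul]

end Universality

end MultConv

open MultConv
theorem mainTheorem6 (n : ℕ) (hn : 1 ≤ n) (Fe Fo : Set (Finset (Fin n)))
    (ν : SignedMeasure (Fin n → ℝ)) (hν : IsIntegrable ν) :
    (UniversalOn ν (symMeasures (stratum Finset.univ) Fe Fo) ↔
      ∀ J ∈ indexFamily Finset.univ Fe Fo,
        mulConv (signDelta Finset.univ J) (coordPart Finset.univ ν) ≠ 0) ∧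
    (UniversalOn ν (symMeasures Set.univ Fe Fo) ↔
      ∀ E : Finset (Fin n), ∀ J ∈ indexFamily E Fe Fo,
        mulConv (signDelta Finset.univ J) (coordPart E (projMeasure E ν)) ≠ 0) ∧
    (HasOrder ν Finset.univ →
      (UniversalOn ν (symMeasures Set.univ Fe Fo) ↔
        ∀ J ∈ indexFamily Finset.univ Fe Fo, mulConv (signDelta J J) ν ≠ 0) ∧
      (UniversalOn ν (symMeasures Set.univ Fe Fo) →
        ∀ E : Finset (Fin n), IsProper (restrictFamily Fe E) (restrictFamily Fo E) →
          ∀ G : Finset (Fin n), G ⊆ E →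
            (EvenUnder G (projMeasure E ν) → G ∈ restrictFamily (evenPart Fe Fo) E) ∧
            (OddUnder G (projMeasure E ν) → G ∈ restrictFamily (oddPart Fe Fo) E))) := by
  refine ⟨universalOn_stratum_univ_iff Fe Fo hν, universalOn_univ_iff Fe Fo hν, fun ho =>
    ⟨universalOn_univ_iff_of_hasOrder Fe Fo hν ho, fun hu E hproper G hG => ⟨fun hG1 => ?_,
      fun hG1 => ?_⟩⟩⟩
  · refine evenPart_restrictFamily_subset Fe Fo E (mem_evenPart_of_mem_span ?_)
    by_contra hcon
    -- An index set with `|J ∩ G|` odd: evenness under `T_G` then cancels the reflection sum for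
    -- `J`, against universality.
    obtain ⟨J, hJ, hcard⟩ := exists_mem_indexFamily hG hproper (c := 1)
      (by rwa [CharTwo.add_self_eq_zero])
    refine (universalOn_univ_iff Fe Fo hν).1 hu E J hJ
      (mulConv_signDelta_coordPart_eq_zero (G := G) (θ := 1) ?_ ?_)
    · rw [one_smul]; exact hG1
    · rw [mul_one, paritySign_of_odd (ZMod.natCast_eq_one_iff_odd.1 hcard)]
  · refine oddPart_restrictFamily_subset Fe Fo E (mem_oddPart_of_mem_span ?_)
    by_contra hcon
    -- Here `|J ∩ G|` is even, which is incompatible with oddness under `T_G`.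
    obtain ⟨J, hJ, hcard⟩ := exists_mem_indexFamily hG hproper (c := 0) (by rwa [zero_add])
    refine (universalOn_univ_iff Fe Fo hν).1 hu E J hJ
      (mulConv_signDelta_coordPart_eq_zero (G := G) (θ := -1) ?_ ?_)
    · exact hG1.trans (neg_one_smul ℝ _).symm
    · rw [paritySign_of_even (ZMod.natCast_eq_zero_iff_even.1 hcard), one_mul]
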